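/- Let $L$ be a field of characteristic zero, let $n\geqslant 1$, and let $f\in L[\mathbf x]=L[x_0,\dots,x_n]$ be a homogeneous polynomial of degree $d$. Assume that the quotient $L[\mathbf x]/(\partial_0 f,\dots,\partial_n f)$ of $L[\mathbf x]$ by the ideal generated by the partial derivatives of $f$ is finite-dimensional over $L$ (in particular $d\geqslant 1$ and $f\neq 0$). Let $L[\mathbf x,\tfrac1f]$ be the ring of rational functions in $L(\mathbf x)$ whose denominator is a power of $f$; for $p\in\mathbb Z$ let $L[\mathbf x,\tfrac1f]_p$ be the subspace of those $F$ that are homogeneous of degree $p$, i.e. $F(\lambda\mathbf x)=\lambda^pF(\mathbf x)$ for all nonzero $\lambda\in L$. Let $D_f$ be the space of all rational functions $\sum_{i=0}^n\partial_iA_i$ with $A_0,\dots,A_n\in L[\mathbf x,\tfrac1f]_{-n}$, and let $H_f^{\mathrm{pr}}=L[\mathbf x,\tfrac1f]_{-n-1}/D_f$. Then $H_f^{\mathrm{pr}}$ is finite-dimensional over $L$ and \[ \dim_L H_f^{\mathrm{pr}}=\frac1d\left((d-1)^{n+1}+(-1)^{n+1}(d-1)\right)\leqslant d^n. \] -/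

import Mathlib

noncomputable section

namespace GriffithsDwork

open MvPolynomial

/-- The field `L(x₀, …, xₙ)` of rational functions. -/
abbrev RatField (L : Type*) [Field L] (n : ℕ) : Type _ :=
  FractionRing (MvPolynomial (Fin (n + 1)) L)

/-- The partial derivative of a rational function, by the quotient rule applied to a chosen
representation `a / b`; see `ratPderivFun_div` for the independence of the choice. -/
def ratPderivFun {L : Type*} [Field L] {n : ℕ} (i : Fin (n + 1)) (F : RatField L n) :
    RatField L n :=
  let s := IsLocalization.sec (nonZeroDivisors (MvPolynomial (Fin (n + 1)) L)) F
  let a : MvPolynomial (Fin (n + 1)) L := s.1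
  let b : MvPolynomial (Fin (n + 1)) L := s.2
  algebraMap _ (RatField L n) (pderiv i a * b - a * pderiv i b) / (algebraMap _ (RatField L n) b) ^ 2

theorem ratPderivFun_div {L : Type*} [Field L] {n : ℕ} (i : Fin (n + 1))
    (a b : MvPolynomial (Fin (n + 1)) L) (hb : b ≠ 0) :
    ratPderivFun i (algebraMap _ (RatField L n) a / algebraMap _ (RatField L n) b) =
      algebraMap _ (RatField L n) (pderiv i a * b - a * pderiv i b) /
        (algebraMap _ (RatField L n) b) ^ 2 := by
  have inj := IsFractionRing.injective (MvPolynomial (Fin (n + 1)) L) (RatField L n)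
  unfold ratPderivFun
  have hs := IsLocalization.sec_spec (nonZeroDivisors (MvPolynomial (Fin (n + 1)) L))
    (algebraMap _ (RatField L n) a / algebraMap _ (RatField L n) b)
  generalize IsLocalization.sec (nonZeroDivisors (MvPolynomial (Fin (n + 1)) L))
    (algebraMap _ (RatField L n) a / algebraMap _ (RatField L n) b) = s at hs
  obtain ⟨c, e, he⟩ := s
  have he0 : e ≠ 0 := nonZeroDivisors.ne_zero he
  have hb' : algebraMap _ (RatField L n) b ≠ 0 := by
    rwa [Ne, map_eq_zero_iff _ inj]
  have he' : algebraMap _ (RatField L n) e ≠ 0 := by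
    rwa [Ne, map_eq_zero_iff _ inj]
  simp only at hs ⊢
  have h1 : a * e = c * b := by
    apply inj
    rw [map_mul, map_mul, ← hs]
    field_simp
  have h2 := congrArg (pderiv i) h1
  simp only [Derivation.leibniz, smul_eq_mul] at h2
  rw [div_eq_div_iff (pow_ne_zero _ he') (pow_ne_zero _ hb'), ← map_pow, ← map_pow, ← map_mul,
    ← map_mul]
  congr 1
  linear_combination (-b * e) * h2 + (b * pderiv i e + e * pderiv i b) * h1

theorem exists_div {L : Type*} [Field L] {n : ℕ} (F : RatField L n) :
    ∃ a b : MvPolynomial (Fin (n + 1)) L, b ≠ 0 ∧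
      F = algebraMap _ (RatField L n) a / algebraMap _ (RatField L n) b := by
  obtain ⟨a, b, hb, rfl⟩ := IsFractionRing.div_surjective (MvPolynomial (Fin (n + 1)) L) F
  exact ⟨a, b, nonZeroDivisors.ne_zero hb, rfl⟩

theorem smul_frac {L : Type*} [Field L] {n : ℕ} (c : L) (p : MvPolynomial (Fin (n + 1)) L)
    (q : RatField L n) :
    c • (algebraMap _ (RatField L n) p / q) = algebraMap _ (RatField L n) (c • p) / q := by
  rw [← smul_div_assoc, ← IsScalarTower.coe_toAlgHom' L (MvPolynomial (Fin (n + 1)) L)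
    (RatField L n), map_smul]

/-- The partial derivative `∂ᵢ` on `L(x₀, …, xₙ)`, as an `L`-linear map. -/
def ratPderiv (L : Type*) [Field L] {n : ℕ} (i : Fin (n + 1)) :
    RatField L n →ₗ[L] RatField L n where
  toFun := ratPderivFun i
  map_add' F G := by
    have inj := IsFractionRing.injective (MvPolynomial (Fin (n + 1)) L) (RatField L n)
    obtain ⟨a, b, hb, rfl⟩ := exists_div F
    obtain ⟨c, e, he, rfl⟩ := exists_div G
    have hb' : algebraMap _ (RatField L n) b ≠ 0 := by
      rwa [Ne, map_eq_zero_iff _ inj]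
    have he' : algebraMap _ (RatField L n) e ≠ 0 := by
      rwa [Ne, map_eq_zero_iff _ inj]
    rw [div_add_div _ _ hb' he', ← map_mul, ← map_mul, ← map_mul, ← map_add,
      ratPderivFun_div i _ _ (mul_ne_zero hb he), ratPderivFun_div i _ _ hb,
      ratPderivFun_div i _ _ he]
    simp only [Derivation.leibniz, smul_eq_mul, map_add, map_mul, map_sub]
    field_simp
    ring
  map_smul' c F := by
    obtain ⟨a, b, hb, rfl⟩ := exists_div F
    rw [RingHom.id_apply, smul_frac, ratPderivFun_div i _ _ hb, ratPderivFun_div i _ _ hb, smul_frac]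
    congr 2
    rw [Derivation.map_smul, smul_sub, smul_mul_assoc, smul_mul_assoc]

/-- The substitution `a(x) ↦ a(c x)` on polynomials. -/
def scale {L : Type*} [Field L] {n : ℕ} (c : Lˣ) :
    MvPolynomial (Fin (n + 1)) L →ₐ[L] MvPolynomial (Fin (n + 1)) L :=
  aeval fun i => C (c : L) * X i

theorem scale_injective {L : Type*} [Field L] {n : ℕ} (c : Lˣ) :
    Function.Injective (scale (n := n) c) := by
  have h : (scale (n := n) c⁻¹).comp (scale c) = AlgHom.id L _ := by
    ext i
    simp [scale, ← mul_assoc, ← C_mul, algHom_C, algebraMap_eq]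
  exact Function.LeftInverse.injective (g := scale c⁻¹) fun a => DFunLike.congr_fun h a

/-- The substitution `F(x) ↦ F(c x)` on rational functions. -/
def ratScale {L : Type*} [Field L] {n : ℕ} (c : Lˣ) : RatField L n →ₐ[L] RatField L n :=
  IsFractionRing.liftAlgHom
    (g := (IsScalarTower.toAlgHom L (MvPolynomial (Fin (n + 1)) L) (RatField L n)).comp (scale c))
    ((IsFractionRing.injective (MvPolynomial (Fin (n + 1)) L) (RatField L n)).comp
      (scale_injective c))

theorem ratScale_algebraMap {L : Type*} [Field L] {n : ℕ} (c : Lˣ)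
    (a : MvPolynomial (Fin (n + 1)) L) :
    ratScale c (algebraMap _ (RatField L n) a) = algebraMap _ (RatField L n) (scale c a) := by
  have hg : Function.Injective (((IsScalarTower.toAlgHom L (MvPolynomial (Fin (n + 1)) L)
      (RatField L n)).comp (scale c)).toRingHom) :=
    (IsFractionRing.injective (MvPolynomial (Fin (n + 1)) L) (RatField L n)).comp
      (scale_injective c)
  exact IsFractionRing.lift_algebraMap hg a

/-- `L[x, 1/f]`: the rational functions of the form `a / f ^ k` with `a` a polynomial. -/
def polesAlong {L : Type*} [Field L] {n : ℕ} (f : MvPolynomial (Fin (n + 1)) L) :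
    Submodule L (RatField L n) where
  carrier := {F | ∃ (a : MvPolynomial (Fin (n + 1)) L) (k : ℕ),
    F = algebraMap _ (RatField L n) a / (algebraMap _ (RatField L n) f) ^ k}
  zero_mem' := ⟨0, 0, by simp⟩
  add_mem' := by
    rintro _ _ ⟨a, k, rfl⟩ ⟨b, l, rfl⟩
    by_cases hf : algebraMap _ (RatField L n) f = 0
    · rcases k with _ | k <;> rcases l with _ | l
      · exact ⟨a + b, 0, by simp⟩
      · exact ⟨a, 0, by simp [hf]⟩
      · exact ⟨b, 0, by simp [hf]⟩
      · exact ⟨0, 0, by simp [hf]⟩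
    · refine ⟨a * f ^ l + f ^ k * b, k + l, ?_⟩
      rw [div_add_div _ _ (pow_ne_zero _ hf) (pow_ne_zero _ hf)]
      simp [pow_add]
  smul_mem' := by
    rintro c _ ⟨a, k, rfl⟩
    exact ⟨c • a, k, smul_frac c a _⟩

/-- `L[x, 1/f]_p`: the elements `F` of `L[x, 1/f]` with `F(c x) = c ^ p F(x)` for all nonzero
scalars `c`. -/
def homogPart {L : Type*} [Field L] {n : ℕ} (f : MvPolynomial (Fin (n + 1)) L) (p : ℤ) :
    Submodule L (RatField L n) where
  carrier := {F | F ∈ polesAlong f ∧ ∀ c : Lˣ, ratScale c F = ((c : L) ^ p) • F}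
  zero_mem' := ⟨zero_mem _, fun c => by simp⟩
  add_mem' := by
    rintro F G ⟨hF, hF'⟩ ⟨hG, hG'⟩
    exact ⟨add_mem hF hG, fun c => by rw [map_add, hF', hG', smul_add]⟩
  smul_mem' := by
    rintro a F ⟨hF, hF'⟩
    exact ⟨Submodule.smul_mem _ a hF, fun c => by rw [map_smul, hF', smul_comm]⟩

/-- `D_f`: the rational functions `∑ᵢ ∂ᵢ Aᵢ` with all `Aᵢ` in `L[x, 1/f]_{-n}`. -/
def exactPart {L : Type*} [Field L] {n : ℕ} (f : MvPolynomial (Fin (n + 1)) L) :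
    Submodule L (RatField L n) where
  carrier := {F | ∃ A : Fin (n + 1) → RatField L n,
    (∀ i, A i ∈ homogPart f (-(n : ℤ))) ∧ F = ∑ i, ratPderiv L i (A i)}
  zero_mem' := ⟨0, fun _ => zero_mem _, by simp⟩
  add_mem' := by
    rintro _ _ ⟨A, hA, rfl⟩ ⟨B, hB, rfl⟩
    exact ⟨A + B, fun i => add_mem (hA i) (hB i), by simp [Finset.sum_add_distrib]⟩
  smul_mem' := by
    rintro c _ ⟨A, hA, rfl⟩
    exact ⟨c • A, fun i => Submodule.smul_mem _ c (hA i), by simp [Finset.smul_sum]⟩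

/-- `H_f^pr = L[x, 1/f]_{-n-1} / D_f`. -/
abbrev Hpr {L : Type*} [Field L] {n : ℕ} (f : MvPolynomial (Fin (n + 1)) L) : Type _ :=
  homogPart f (-(n : ℤ) - 1) ⧸ (exactPart f).submoduleOf (homogPart f (-(n : ℤ) - 1))

/-- The Jacobian ideal `(∂₀ f, …, ∂ₙ f)` of `L[x₀, …, xₙ]`. -/
def jacobianIdeal {L : Type*} [Field L] {n : ℕ} (f : MvPolynomial (Fin (n + 1)) L) :
    Ideal (MvPolynomial (Fin (n + 1)) L) :=
  Ideal.span (Set.range fun i => pderiv i f)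

end GriffithsDwork

end

/-! Write an element of degree -n-1 as P / f^k with deg P = kd - n - 1. Since ∑ ∂ᵢ(Qᵢ / f^k) = (f ∑
∂ᵢQᵢ - k ∑ Qᵢ ∂ᵢf) / f^(k+1), a numerator in the Jacobian ideal J lets the pole order drop modulo
D_f. Griffiths' converse (`mem_span_pderiv_of_exact`) says that P ∈ J whenever P / f^k is exact,
whatever the pole orders of the primitives. Hence the pole filtration of H_f^pr has graded pieces
(L[x]/J) in degrees kd - n - 1, and the dimension is a sum of values of the Hilbert function of
L[x]/J (`idealPart_jacobianIdeal_succ`, `finrank_Hpr`).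

The converse needs every syzygy of the partials to be Koszul: Euler's identity turns exactness into
a syzygy, and the divergence of its Koszul expression gives a primitive with a smaller pole
(`exists_reduction`).

Koszul syzygies and the Hilbert function both come from regular sequences. J contains a power of
every variable, and the variables themselves form a regular sequence of length n + 1; by exchange
and prime avoidance, so do suitable L-combinations of the partials when d > 1 (`DepthGE.sup_span`,
`exists_regular_matrix`). The Hilbert series is therefore (1 + t + ⋯ + t^(d-2))^(n+1)
(`hilbSeries_eq_geom`).

It remains to add the coefficients of (t + ⋯ + t^(d-1))^(n+1) at multiples of d. With n + 1 replaced
by N, this sum s_N satisfies s_(N+1) = (d-1)^N - s_N (`multSum_pow`). -/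

noncomputable section

namespace GriffithsDwork

/-! ### Regular sequences, depth and Koszul syzygies in commutative rings. -/

section Regular

variable {R : Type*} [CommRing R]

/-- `a` is a nonzerodivisor modulo `I`. -/
def RegOn (I : Ideal R) (a : R) : Prop := ∀ z, a * z ∈ I → z ∈ I

theorem mem_sup_span {I : Ideal R} {a z : R} :
    z ∈ I ⊔ Ideal.span {a} ↔ ∃ w, z - a * w ∈ I := by
  rw [sup_comm, Ideal.mem_span_singleton_sup]
  constructor
  · rintro ⟨w, b, hb, rfl⟩
    exact ⟨w, by convert hb using 1; ring⟩
  · rintro ⟨w, hw⟩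
    exact ⟨w, _, hw, by ring⟩

theorem sup_span_comm (I : Ideal R) (a b : R) :
    I ⊔ Ideal.span {a} ⊔ Ideal.span {b} = I ⊔ Ideal.span {b} ⊔ Ideal.span {a} :=
  sup_right_comm _ _ _

/-- The half of the permutability of regular sequences that needs no local or graded hypothesis. -/
theorem RegOn.swap {I : Ideal R} {a c : R} (ha : RegOn I a) (hc : RegOn (I ⊔ Ideal.span {a}) c) :
    RegOn (I ⊔ Ideal.span {c}) a := by
  intro z hz
  obtain ⟨w, hw⟩ := mem_sup_span.1 hz
  have h1 : w ∈ I ⊔ Ideal.span {a} := by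
    refine hc _ (mem_sup_span.2 ⟨z, ?_⟩)
    convert I.neg_mem hw using 1
    ring
  obtain ⟨w', hw'⟩ := mem_sup_span.1 h1
  refine mem_sup_span.2 ⟨w', ha _ ?_⟩
  convert I.add_mem hw (I.mul_mem_left c hw') using 1
  ring

/-- If the socle of `R / (I + a)` with respect to `m` vanishes, so does that of `R / (I + b)`,
for nonzerodivisors `a`, `b` in `m`. -/
theorem socle_exchange {I m : Ideal R} {a b : R} (ham : a ∈ m)
    (ha : RegOn I a) (hb : RegOn I b)
    (h : ∀ z, (∀ x ∈ m, x * z ∈ I ⊔ Ideal.span {a}) → z ∈ I ⊔ Ideal.span {a}) (z : R)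
    (hz : ∀ x ∈ m, x * z ∈ I ⊔ Ideal.span {b}) : z ∈ I ⊔ Ideal.span {b} := by
  -- The relation a z ≡ b w modulo I carries a socle element z modulo I + (b) to a socle element w
  -- modulo I + (a).
  obtain ⟨w, hw⟩ := mem_sup_span.1 (hz a ham)
  have h1 : w ∈ I ⊔ Ideal.span {a} := by
    refine h w fun x hx => ?_
    obtain ⟨z', hz'⟩ := mem_sup_span.1 (hz x hx)
    refine mem_sup_span.2 ⟨z', hb _ ?_⟩
    convert I.sub_mem (I.mul_mem_left a hz') (I.mul_mem_left x hw) using 1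
    ring
  obtain ⟨w', hw'⟩ := mem_sup_span.1 h1
  refine mem_sup_span.2 ⟨w', ha _ ?_⟩
  convert I.add_mem hw (I.mul_mem_left b hw') using 1
  ring

/-- In a Noetherian ring the zerodivisors modulo `I` are the union of finitely many primes, each
of which is the annihilator of a nonzero element of `R / I`. -/
theorem exists_finite_primes [IsNoetherianRing R] (I : Ideal R) :
    ∃ S : Set (Ideal R), S.Finite ∧ (∀ P ∈ S, P.IsPrime ∧ ∃ z, z ∉ I ∧ ∀ x, x ∈ P ↔ x * z ∈ I) ∧
      ∀ a, RegOn I a ↔ ∀ P ∈ S, a ∉ P := by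
  refine ⟨associatedPrimes R (R ⧸ I), associatedPrimes.finite R (R ⧸ I), ?_, ?_⟩
  · intro P hP
    obtain ⟨hP, x, hx⟩ := isAssociatedPrime_iff.1 hP
    obtain ⟨z, rfl⟩ := Ideal.Quotient.mk_surjective x
    have key : ∀ x, x ∈ P ↔ x * z ∈ I := fun x => by
      rw [hx, Submodule.mem_colon_singleton, Submodule.mem_bot, ← Ideal.Quotient.eq_zero_iff_mem,
        map_mul]
      rfl
    refine ⟨hP, z, fun hz => hP.ne_top ((Ideal.eq_top_iff_one _).2 ?_), key⟩
    rw [key]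
    simpa using hz
  · intro a
    have h := Set.ext_iff.1 (biUnion_associatedPrimes_eq_zero_divisors R (R ⧸ I)) a
    simp only [Set.mem_iUnion, SetLike.mem_coe, exists_prop, Set.mem_ofPred] at h
    have h' : (∃ x : R ⧸ I, x ≠ 0 ∧ a • x = 0) ↔ ¬ RegOn I a := by
      unfold RegOn
      push Not
      constructor
      · rintro ⟨x, hx, hax⟩
        obtain ⟨z, rfl⟩ := Ideal.Quotient.mk_surjective x
        refine ⟨z, ?_, fun hz => hx (Ideal.Quotient.eq_zero_iff_mem.2 hz)⟩
        rw [← Ideal.Quotient.eq_zero_iff_mem, map_mul]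
        exact hax
      · rintro ⟨z, hz, hz'⟩
        refine ⟨Ideal.Quotient.mk I z, fun h => hz' (Ideal.Quotient.eq_zero_iff_mem.1 h), ?_⟩
        rw [← Ideal.Quotient.eq_zero_iff_mem, map_mul] at hz
        exact hz
    rw [h'] at h
    rw [← not_iff_not, ← h]
    push Not
    rfl

/-- There is a regular sequence of length `r` in `m` modulo `I`. -/
def DepthGE (m : Ideal R) : ℕ → Ideal R → Prop
  | 0, _ => True
  | r + 1, I => ∃ a ∈ m, RegOn I a ∧ DepthGE m r (I ⊔ Ideal.span {a})

theorem DepthGE.exists_regOn {m I : Ideal R} {r : ℕ} (h : DepthGE m (r + 1) I) :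
    ∃ a ∈ m, RegOn I a :=
  let ⟨a, ha, h, _⟩ := h
  ⟨a, ha, h⟩

theorem exists_common_regOn [IsNoetherianRing R] {m : Ideal R} {I₁ I₂ I₃ : Ideal R}
    (h₁ : ∃ a ∈ m, RegOn I₁ a) (h₂ : ∃ a ∈ m, RegOn I₂ a) (h₃ : ∃ a ∈ m, RegOn I₃ a) :
    ∃ c ∈ m, RegOn I₁ c ∧ RegOn I₂ c ∧ RegOn I₃ c := by
  obtain ⟨S₁, hf₁, hp₁, hS₁⟩ := exists_finite_primes I₁
  obtain ⟨S₂, hf₂, hp₂, hS₂⟩ := exists_finite_primes I₂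
  obtain ⟨S₃, hf₃, hp₃, hS₃⟩ := exists_finite_primes I₃
  by_contra hcon
  have hsub : (m : Set R) ⊆ ⋃ P ∈ S₁ ∪ S₂ ∪ S₃, ((id P : Ideal R) : Set R) := by
    intro c hc
    by_contra hc'
    simp only [Set.mem_iUnion, not_exists, id] at hc'
    exact hcon ⟨c, hc, (hS₁ c).2 fun P hP => hc' P (.inl (.inl hP)),
      (hS₂ c).2 fun P hP => hc' P (.inl (.inr hP)), (hS₃ c).2 fun P hP => hc' P (.inr hP)⟩
  -- Prime avoidance permits two exceptional non-prime indices; all members here are prime, so `0 0`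
  -- is a dummy choice.
  rw [Ideal.subset_union_prime_finite ((hf₁.union hf₂).union hf₃) 0 0] at hsub
  · obtain ⟨P, (hP | hP) | hP, hmP⟩ := hsub
    · obtain ⟨a, ha, ha'⟩ := h₁
      exact (hS₁ a).1 ha' P hP (hmP ha)
    · obtain ⟨a, ha, ha'⟩ := h₂
      exact (hS₂ a).1 ha' P hP (hmP ha)
    · obtain ⟨a, ha, ha'⟩ := h₃
      exact (hS₃ a).1 ha' P hP (hmP ha)
  · rintro P ((hP | hP) | hP) _ _
    · exact (hp₁ P hP).1
    · exact (hp₂ P hP).1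
    · exact (hp₃ P hP).1

/-- Otherwise prime avoidance puts m inside one associated prime, the annihilator of a nonzero
class, and that class lies in the socle. -/
theorem exists_regOn_of_socle [IsNoetherianRing R] {m : Ideal R} {I : Ideal R}
    (h : ∀ z, (∀ x ∈ m, x * z ∈ I) → z ∈ I) : ∃ a ∈ m, RegOn I a := by
  obtain ⟨S, hf, hp, hS⟩ := exists_finite_primes I
  by_contra hcon
  have hsub : (m : Set R) ⊆ ⋃ P ∈ S, ((id P : Ideal R) : Set R) := by
    intro c hc
    by_contra hc'
    simp only [Set.mem_iUnion, not_exists, id] at hc'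
    exact hcon ⟨c, hc, (hS c).2 hc'⟩
  rw [Ideal.subset_union_prime_finite hf (f := id) 0 0 fun P hP _ _ => (hp P hP).1] at hsub
  obtain ⟨P, hP, hmP⟩ := hsub
  obtain ⟨-, z, hz, hz'⟩ := hp P hP
  exact hz (h z fun x hx => (hz' x).1 (hmP hx))

theorem RegOn.socle {m I : Ideal R} (h : ∃ a ∈ m, RegOn I a) (z : R)
    (hz : ∀ x ∈ m, x * z ∈ I) : z ∈ I :=
  let ⟨a, ha, h⟩ := h
  h z (hz a ha)

/-- Dividing by any nonzerodivisor lowers the depth by at most one. -/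
theorem DepthGE.sup_span [IsNoetherianRing R] {m : Ideal R} {r : ℕ} :
    ∀ {I : Ideal R} {b : R}, DepthGE m (r + 1) I → b ∈ m → RegOn I b →
      DepthGE m r (I ⊔ Ideal.span {b}) := by
  induction r with
  | zero => intros; trivial
  | succ r ih =>
    rintro I b ⟨a, ham, ha, hda⟩ hbm hb
    have hsoc := socle_exchange ham ha hb (RegOn.socle hda.exists_regOn)
    -- A common nonzerodivisor c modulo I, I + (a) and I + (b) mediates the exchange: a is replaced
    -- by c, then c by b.
    obtain ⟨c, hcm, hc, hca, hcb⟩ :=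
      exists_common_regOn ⟨a, ham, ha⟩ hda.exists_regOn (exists_regOn_of_socle hsoc)
    have h1 : DepthGE m (r + 1) (I ⊔ Ideal.span {c}) :=
      ⟨a, ham, ha.swap hca, by rw [sup_span_comm]; exact ih hda hcm hca⟩
    exact ⟨c, hcm, hcb, by rw [sup_span_comm]; exact ih h1 hbm (hb.swap hcb)⟩

/-- The ideal generated by the first `r` terms of a sequence. -/
def seqIdeal (g : ℕ → R) : ℕ → Ideal R
  | 0 => ⊥
  | r + 1 => seqIdeal g r ⊔ Ideal.span {g r}

theorem mem_seqIdeal {g : ℕ → R} {r : ℕ} {z : R} :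
    z ∈ seqIdeal g r ↔ ∃ c : ℕ → R, z = ∑ i ∈ Finset.range r, c i * g i := by
  induction r generalizing z with
  | zero => simp [seqIdeal]
  | succ r ih =>
    rw [seqIdeal, mem_sup_span]
    constructor
    · rintro ⟨w, hw⟩
      obtain ⟨c, hc⟩ := ih.1 hw
      refine ⟨Function.update c r w, ?_⟩
      rw [Finset.sum_range_succ, Finset.sum_congr rfl (g := fun i => c i * g i), ← hc]
      · simp; ring
      · intro i hi
        rw [Function.update_of_ne (Finset.mem_range.1 hi).ne]
    · rintro ⟨c, rfl⟩
      refine ⟨c r, ih.2 ⟨c, ?_⟩⟩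
      rw [Finset.sum_range_succ]; ring

theorem seqIdeal_congr {g h : ℕ → R} {r : ℕ} (H : ∀ i < r, g i = h i) :
    seqIdeal g r = seqIdeal h r := by
  induction r with
  | zero => rfl
  | succ r ih => rw [seqIdeal, seqIdeal, ih fun i hi => H i (hi.trans r.lt_succ_self),
      H r r.lt_succ_self]

/-- Syzygies of a regular sequence are Koszul syzygies. -/
theorem koszul_of_regular {g : ℕ → R} {r : ℕ} (hg : ∀ i < r, RegOn (seqIdeal g i) (g i))
    (Q : ℕ → R) (hQ : ∑ i ∈ Finset.range r, Q i * g i = 0) :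
    ∃ W : ℕ → ℕ → R, (∀ i j, W i j = - W j i) ∧
      ∀ i < r, Q i = ∑ j ∈ Finset.range r, W i j * g j := by
  induction r generalizing Q with
  | zero => exact ⟨0, by simp, by simp⟩
  | succ r ih =>
    rw [Finset.sum_range_succ] at hQ
    -- Regularity of the last term gives Q r = ∑ cᵢ gᵢ. Then Qᵢ + cᵢ g_r is a syzygy of the shorter
    -- sequence, and its matrix is bordered by ∓c.
    have h1 : Q r ∈ seqIdeal g r := by
      refine hg r r.lt_succ_self _ (mem_seqIdeal.2 ⟨fun i => - Q i, ?_⟩)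
      simp only [neg_mul, Finset.sum_neg_distrib]
      linear_combination hQ
    obtain ⟨c, hc⟩ := mem_seqIdeal.1 h1
    obtain ⟨W, hW, hWQ⟩ := ih (fun i hi => hg i (hi.trans r.lt_succ_self))
      (fun i => Q i + c i * g r) (by
        simp only [add_mul, Finset.sum_add_distrib]
        rw [← hQ, hc, Finset.sum_mul]
        congr 1
        exact Finset.sum_congr rfl fun i _ => by ring)
    refine ⟨fun i j => if i < r then (if j < r then W i j else if j = r then - c i else 0)
      else if i = r then (if j < r then c j else 0) else 0, ?_, ?_⟩
    · intro i j
      dsimp only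
      split_ifs <;> first | exact hW i j | simp
    · intro i hi
      rw [Finset.sum_range_succ]
      rcases Nat.lt_succ_iff_lt_or_eq.1 hi with hi | hi
      · rw [Finset.sum_congr rfl (g := fun j => W i j * g j)]
        · simp only [hi, if_true, lt_irrefl, if_false]
          linear_combination hWQ i hi
        · intro j hj
          simp [hi, Finset.mem_range.1 hj]
      · rw [Finset.sum_congr rfl (g := fun j => c j * g j)]
        · simp [hi, hc]
        · intro j hj
          simp [hi, Finset.mem_range.1 hj]

end Regular

/-! ### The integer grading of polynomials and Hilbert functions of homogeneous ideals. -/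

section Grading

open MvPolynomial

variable {L σ : Type*} [Field L]

/-- The polynomials all of whose monomials have degree `p`, for an integer `p`. -/
abbrev gr (L σ : Type*) [Field L] (p : ℤ) : Submodule L (MvPolynomial σ L) :=
  weightedHomogeneousSubmodule L (fun _ => (1 : ℤ)) p

/-- The component of degree `p`, for an integer `p`. -/
abbrev comp (p : ℤ) : MvPolynomial σ L →ₗ[L] MvPolynomial σ L :=
  weightedHomogeneousComponent (fun _ => (1 : ℤ)) p

theorem weight_one_int (m : σ →₀ ℕ) : Finsupp.weight (fun _ => (1 : ℤ)) m = (m.degree : ℤ) := by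
  simp [Finsupp.weight_apply, Finsupp.degree_apply, Finsupp.sum]

theorem mem_gr {p : ℤ} {P : MvPolynomial σ L} :
    P ∈ gr L σ p ↔ ∀ m, coeff m P ≠ 0 → (m.degree : ℤ) = p := by
  simp only [mem_weightedHomogeneousSubmodule, IsWeightedHomogeneous, weight_one_int]

theorem mem_gr_natCast {d : ℕ} {P : MvPolynomial σ L} :
    P ∈ gr L σ (d : ℤ) ↔ P.IsHomogeneous d := by
  rw [mem_gr, IsHomogeneous, IsWeightedHomogeneous]
  refine forall_congr' fun m => ?_
  rw [Finsupp.degree_eq_weight_one, Nat.cast_inj]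
  rfl

theorem gr_mul {p q : ℤ} {P Q : MvPolynomial σ L} (hP : P ∈ gr L σ p) (hQ : Q ∈ gr L σ q) :
    P * Q ∈ gr L σ (p + q) :=
  IsWeightedHomogeneous.mul hP hQ

theorem gr_pow {p : ℤ} {P : MvPolynomial σ L} (hP : P ∈ gr L σ p) (k : ℕ) :
    P ^ k ∈ gr L σ (k * p) := by
  simpa using IsWeightedHomogeneous.pow hP k

theorem gr_pderiv {p : ℤ} {P : MvPolynomial σ L} (hP : P ∈ gr L σ p) (i : σ) :
    pderiv i P ∈ gr L σ (p - 1) :=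
  IsWeightedHomogeneous.pderiv hP (by ring)

theorem X_mem_gr (i : σ) : (X i : MvPolynomial σ L) ∈ gr L σ 1 :=
  isWeightedHomogeneous_X L _ i

theorem eq_zero_of_mem_gr_neg {p : ℤ} (hp : p < 0) {P : MvPolynomial σ L} (hP : P ∈ gr L σ p) :
    P = 0 := by
  ext m
  by_contra h
  have := mem_gr.1 hP m h
  omega

theorem gr_neg {p : ℤ} (hp : p < 0) : gr L σ p = ⊥ :=
  (Submodule.eq_bot_iff _).2 fun _ => eq_zero_of_mem_gr_neg hp

instance finiteDimensional_gr [Finite σ] (p : ℤ) : FiniteDimensional L (gr L σ p) := by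
  rcases lt_or_ge p 0 with hp | hp
  · rw [gr_neg hp]; infer_instance
  · obtain ⟨d, rfl⟩ := Int.eq_ofNat_of_zero_le hp
    have : gr L σ (d : ℤ) = homogeneousSubmodule σ L d := by
      ext P
      rw [mem_gr_natCast, mem_homogeneousSubmodule]
    rw [this]
    exact Module.Finite.iff_fg.2 (homogeneousSubmodule_fg _ _ _)

theorem comp_mem (p : ℤ) (P : MvPolynomial σ L) : comp p P ∈ gr L σ p :=
  weightedHomogeneousComponent_mem _ _ _

theorem comp_of_mem {p q : ℤ} {P : MvPolynomial σ L} (hP : P ∈ gr L σ q) :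
    comp p P = if p = q then P else 0 :=
  weightedHomogeneousComponent_of_mem hP

theorem comp_self {p : ℤ} {P : MvPolynomial σ L} (hP : P ∈ gr L σ p) : comp p P = P := by
  rw [comp_of_mem hP, if_pos rfl]

theorem comp_mul (p : ℤ) {q : ℤ} (a : MvPolynomial σ L) {b : MvPolynomial σ L}
    (hb : b ∈ gr L σ q) : comp p (a * b) = comp (p - q) a * b := by
  induction a using MvPolynomial.induction_on' with
  | monomial m c =>
    have h : monomial m c ∈ gr L σ (m.degree : ℤ) :=
      isWeightedHomogeneous_monomial _ _ _ (weight_one_int m)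
    rw [comp_of_mem h, comp_of_mem (gr_mul h hb), ite_mul, zero_mul]
    congr 1
    rw [eq_iff_iff]
    omega
  | add P Q hP hQ => rw [add_mul, map_add, hP, hQ, map_add, add_mul]

/-- An ideal that contains the homogeneous components of its elements. -/
def HomIdeal (I : Ideal (MvPolynomial σ L)) : Prop := ∀ z ∈ I, ∀ p, comp p z ∈ I

theorem HomIdeal.sup_span {I : Ideal (MvPolynomial σ L)} (hI : HomIdeal I) {e : ℤ}
    {g : MvPolynomial σ L} (hg : g ∈ gr L σ e) : HomIdeal (I ⊔ Ideal.span {g}) := by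
  intro z hz p
  obtain ⟨w, hw⟩ := mem_sup_span.1 hz
  refine mem_sup_span.2 ⟨comp (p - e) w, ?_⟩
  have := hI _ hw p
  rwa [map_sub, mul_comm, comp_mul p w hg, mul_comm] at this

theorem homIdeal_seqIdeal {g : ℕ → MvPolynomial σ L} {e : ℤ} {r : ℕ}
    (hg : ∀ i < r, g i ∈ gr L σ e) : HomIdeal (seqIdeal g r) := by
  induction r with
  | zero =>
    intro z hz p
    rw [(Submodule.mem_bot _).1 hz, map_zero]
    exact zero_mem _
  | succ r ih => exact (ih fun i hi => hg i (hi.trans r.lt_succ_self)).sup_span (hg r r.lt_succ_self)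

/-- The degree `p` part of an ideal. -/
abbrev idealPart (I : Ideal (MvPolynomial σ L)) (p : ℤ) : Submodule L (MvPolynomial σ L) :=
  I.restrictScalars L ⊓ gr L σ p

/-- The Hilbert function of the quotient by an ideal. -/
def hilb (I : Ideal (MvPolynomial σ L)) (p : ℤ) : ℤ :=
  Module.finrank L (gr L σ p) - Module.finrank L (idealPart I p)

theorem hilb_neg (I : Ideal (MvPolynomial σ L)) {p : ℤ} (hp : p < 0) : hilb I p = 0 := by
  have : idealPart I p = ⊥ := by
    rw [idealPart, gr_neg hp, inf_bot_eq]
  rw [hilb, this, gr_neg hp, sub_self]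

theorem finrank_map_of_injective {V W : Type*} [AddCommGroup V] [Module L V] [AddCommGroup W]
    [Module L W] {φ : V →ₗ[L] W} (hφ : Function.Injective φ) (S : Submodule L V) :
    Module.finrank L (S.map φ) = Module.finrank L S :=
  (Submodule.equivMapOfInjective φ hφ S).finrank_eq.symm

/-- The exact sequence 0 → (R/I)(-e) → R/I → R/(I + g) → 0, read off inside R: the new degree-p part
is a sum of two subspaces whose intersection is g times the degree p - e part of I. -/
theorem hilb_sup_span [Finite σ] {I : Ideal (MvPolynomial σ L)} (hI : HomIdeal I) {e : ℤ}
    {g : MvPolynomial σ L} (hg : g ∈ gr L σ e) (hg0 : g ≠ 0) (hreg : RegOn I g) (p : ℤ) :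
    hilb (I ⊔ Ideal.span {g}) p = hilb I p - hilb I (p - e) := by
  have hinj : Function.Injective (LinearMap.mulLeft L g) := mul_right_injective₀ hg0
  have h1 : idealPart (I ⊔ Ideal.span {g}) p =
      idealPart I p ⊔ (gr L σ (p - e)).map (LinearMap.mulLeft L g) := by
    apply le_antisymm
    · rintro z ⟨hz, hzp⟩
      obtain ⟨w, hw⟩ := mem_sup_span.1 hz
      have h := hI _ hw p
      rw [map_sub, mul_comm, comp_mul p w hg, comp_self hzp] at h
      refine Submodule.mem_sup.2 ⟨_, ⟨h, ?_⟩, _, ⟨_, comp_mem (p - e) w, rfl⟩, ?_⟩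
      · refine sub_mem hzp ?_
        have := gr_mul (comp_mem (p - e) w) hg
        rwa [sub_add_cancel] at this
      · simp [mul_comm]
    · refine sup_le (inf_le_inf_right _ fun z hz => Ideal.mem_sup_left hz) ?_
      rintro _ ⟨w, hw, rfl⟩
      refine ⟨Ideal.mem_sup_right (Ideal.mul_mem_right _ _ (Ideal.mem_span_singleton_self g)), ?_⟩
      have := gr_mul hg hw
      rwa [add_sub_cancel] at this
  have h2 : idealPart I p ⊓ (gr L σ (p - e)).map (LinearMap.mulLeft L g) =
      (idealPart I (p - e)).map (LinearMap.mulLeft L g) := by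
    apply le_antisymm
    · rintro _ ⟨⟨hz, -⟩, w, hw, rfl⟩
      exact ⟨w, ⟨hreg _ hz, hw⟩, rfl⟩
    · rintro _ ⟨w, ⟨hw, hw'⟩, rfl⟩
      refine ⟨⟨Ideal.mul_mem_left _ _ hw, ?_⟩, w, hw', rfl⟩
      have := gr_mul hg hw'
      rwa [add_sub_cancel] at this
  have : FiniteDimensional L (idealPart I p) :=
    Submodule.finiteDimensional_of_le (S₂ := gr L σ p) inf_le_right
  have h3 := Submodule.finrank_sup_add_finrank_inf_eq (idealPart I p)
    ((gr L σ (p - e)).map (LinearMap.mulLeft L g))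
  rw [← h1, h2, finrank_map_of_injective hinj,
    finrank_map_of_injective hinj] at h3
  unfold hilb
  omega

end Grading

/-! ### Regular sequences made of linear combinations of given elements. -/

section Choice

theorem DepthGE.of_regular {R : Type*} [CommRing R] {m : Ideal R} {g : ℕ → R} {N : ℕ}
    (hm : ∀ i < N, g i ∈ m) (hg : ∀ i < N, RegOn (seqIdeal g i) (g i)) :
    ∀ k r, r + k = N → DepthGE m k (seqIdeal g r) := by
  intro k
  induction k with
  | zero => intros; trivial
  | succ k ih =>
    intro r hr
    exact ⟨g r, hm r (by omega), hg r (by omega), ih (r + 1) (by omega)⟩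

/-- For each associated prime P the coefficients c with ∑ cᵢ fᵢ ∈ P form a subspace. It is proper,
since otherwise m ≤ P would contain no nonzerodivisor; finitely many proper subspaces over an
infinite field do not cover. -/
theorem exists_combination_regOn {L R ι : Type*} [Field L] [Infinite L] [CommRing R]
    [IsNoetherianRing R] [Algebra L R] [Fintype ι] {m I : Ideal R} {f : ι → R}
    (hm : ∀ P : Ideal R, P.IsPrime → (∀ i, f i ∈ P) → m ≤ P) (h : ∃ a ∈ m, RegOn I a) :
    ∃ c : ι → L, RegOn I (∑ i, c i • f i) := by
  classical
  obtain ⟨S, hfin, hp, hS⟩ := exists_finite_primes I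
  let V : Ideal R → Subspace L (ι → L) := fun P =>
    (P.restrictScalars L).comap (Fintype.linearCombination L f)
  have htop : (⊤ : Subspace L (ι → L)) ∉ hfin.toFinset.image V := by
    intro hmem
    obtain ⟨P, hP, hPV⟩ := Finset.mem_image.1 hmem
    rw [Set.Finite.mem_toFinset] at hP
    obtain ⟨a, ham, ha⟩ := h
    refine (hS a).1 ha P hP (hm P (hp P hP).1 (fun i => ?_) ham)
    have : Pi.single i (1 : L) ∈ V P := by rw [hPV]; trivial
    simpa [V] using this
  obtain ⟨c, hc⟩ := (Set.ne_univ_iff_exists_notMem _).1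
    (Subspace.biUnion_ne_univ_of_top_notMem htop)
  refine ⟨c, (hS _).2 fun P hP hcP => hc ?_⟩
  simp only [Set.mem_iUnion]
  exact ⟨V P, Finset.mem_image.2 ⟨P, by simpa using hP, rfl⟩, hcP⟩

theorem exists_regular_combinations {L R ι : Type*} [Field L] [Infinite L] [CommRing R]
    [IsNoetherianRing R] [Algebra L R] [Fintype ι] {m : Ideal R} {f : ι → R}
    (hm : ∀ P : Ideal R, P.IsPrime → (∀ i, f i ∈ P) → m ≤ P) (hf : ∀ i, f i ∈ m) {N : ℕ}
    (hN : DepthGE m N (⊥ : Ideal R)) :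
    ∃ A : ℕ → ι → L, ∀ i < N,
      RegOn (seqIdeal (fun l => ∑ j, A l j • f j) i) (∑ j, A i j • f j) := by
  -- The remaining depth k is carried along; it guarantees a nonzerodivisor in m at the next step.
  suffices H : ∀ r k, r + k = N → ∃ A : ℕ → ι → L,
      (∀ i < r, RegOn (seqIdeal (fun l => ∑ j, A l j • f j) i) (∑ j, A i j • f j)) ∧
      DepthGE m k (seqIdeal (fun l => ∑ j, A l j • f j) r) by
    obtain ⟨A, hA, -⟩ := H N 0 rfl
    exact ⟨A, hA⟩
  intro r
  induction r with
  | zero =>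
    rintro k hk
    obtain rfl : k = N := by omega
    exact ⟨0, by simp, hN⟩
  | succ r ih =>
    rintro k hk
    obtain ⟨A, hA, hd⟩ := ih (k + 1) (by omega)
    obtain ⟨c, hc⟩ := exists_combination_regOn (L := L) hm hd.exists_regOn
    have hcongr : ∀ i ≤ r, seqIdeal (fun l => ∑ j, Function.update A r c l j • f j) i =
        seqIdeal (fun l => ∑ j, A l j • f j) i := fun i hi =>
      seqIdeal_congr fun l hl => by rw [Function.update_of_ne (by omega)]
    have hmem : ∑ j, c j • f j ∈ m := Ideal.sum_mem _ fun j _ => by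
      rw [Algebra.smul_def]; exact Ideal.mul_mem_left _ _ (hf j)
    refine ⟨Function.update A r c, fun i hi => ?_, ?_⟩
    · rw [hcongr i (by omega)]
      rcases Nat.lt_succ_iff_lt_or_eq.1 hi with hi | rfl
      · rw [Function.update_of_ne (by omega)]
        exact hA i hi
      · simpa using hc
    · rw [seqIdeal, hcongr r le_rfl]
      simpa using hd.sup_span hmem hc

end Choice

/-! ### The variables as a regular sequence, and the Hilbert series of the polynomial ring. -/

section Variables

open MvPolynomial

variable {L : Type*} [Field L] {N : ℕ}

/-- The sequence of variables, extended by zero. -/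
def varSeq (L : Type*) [Field L] (N : ℕ) (i : ℕ) : MvPolynomial (Fin N) L :=
  if h : i < N then X ⟨i, h⟩ else 0

theorem varSeq_of_lt {i : ℕ} (h : i < N) : varSeq L N i = X ⟨i, h⟩ := dif_pos h

theorem seqIdeal_varSeq {r : ℕ} (hr : r ≤ N) :
    seqIdeal (varSeq L N) r = Ideal.span (X '' {i : Fin N | (i : ℕ) < r}) := by
  induction r with
  | zero => simp [seqIdeal]
  | succ r ih =>
    have : {i : Fin N | (i : ℕ) < r + 1} = {i : Fin N | (i : ℕ) < r} ∪ {⟨r, hr⟩} := by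
      ext i
      simp [Fin.ext_iff]
      omega
    rw [seqIdeal, ih (by omega), this, Set.image_union, Ideal.span_union, Set.image_singleton,
      varSeq_of_lt hr]

theorem regOn_varSeq {r : ℕ} (hr : r < N) : RegOn (seqIdeal (varSeq L N) r) (varSeq L N r) := by
  intro z hz
  rw [seqIdeal_varSeq hr.le, mem_ideal_span_X_image] at hz ⊢
  intro m hm
  obtain ⟨i, hi, him⟩ := hz (Finsupp.single ⟨r, hr⟩ 1 + m) (by
    rw [mem_support_iff, varSeq_of_lt hr, coeff_X_mul]
    exact mem_support_iff.1 hm)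
  refine ⟨i, hi, ?_⟩
  have hne : (⟨r, hr⟩ : Fin N) ≠ i := by
    rintro rfl
    simp at hi
  simpa [Finsupp.single_apply, hne] using him

theorem varSeq_mem_gr {i : ℕ} (hi : i < N) : varSeq L N i ∈ gr L (Fin N) 1 := by
  rw [varSeq_of_lt hi]; exact X_mem_gr _

theorem hilb_seqIdeal_succ {g : ℕ → MvPolynomial (Fin N) L} {e : ℤ} {r : ℕ}
    (hg : ∀ i ≤ r, g i ∈ gr L (Fin N) e) (hg0 : g r ≠ 0) (hreg : RegOn (seqIdeal g r) (g r))
    (p : ℤ) : hilb (seqIdeal g (r + 1)) p = hilb (seqIdeal g r) p - hilb (seqIdeal g r) (p - e) :=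
  hilb_sup_span (homIdeal_seqIdeal fun i hi => hg i hi.le) (hg r le_rfl) hg0 hreg p

/-- The Hilbert series of the quotient by an ideal. -/
def hilbSeries (I : Ideal (MvPolynomial (Fin N) L)) : PowerSeries ℚ :=
  PowerSeries.mk fun k => (hilb I (k : ℤ) : ℚ)

/-- Each regular element of degree e multiplies the series by 1 - t^e. -/
theorem hilbSeries_seqIdeal {g : ℕ → MvPolynomial (Fin N) L} {e : ℕ} {r : ℕ}
    (hg : ∀ i < r, g i ∈ gr L (Fin N) e) (hg0 : ∀ i < r, g i ≠ 0)
    (hreg : ∀ i < r, RegOn (seqIdeal g i) (g i)) :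
    hilbSeries (seqIdeal g r) = (1 - PowerSeries.X ^ e) ^ r *
      hilbSeries (⊥ : Ideal (MvPolynomial (Fin N) L)) := by
  induction r with
  | zero => simp [seqIdeal]
  | succ r ih =>
    rw [pow_succ', mul_assoc, ← ih (fun i hi => hg i (by omega)) (fun i hi => hg0 i (by omega))
      (fun i hi => hreg i (by omega))]
    ext k
    rw [sub_mul, one_mul, map_sub, PowerSeries.coeff_X_pow_mul', hilbSeries, hilbSeries,
      PowerSeries.coeff_mk, PowerSeries.coeff_mk, hilb_seqIdeal_succ (fun i hi => hg i (by omega))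
      (hg0 r (by omega)) (hreg r (by omega))]
    push_cast
    congr 1
    split_ifs with h
    · rw [PowerSeries.coeff_mk, Nat.cast_sub h]
    · rw [hilb_neg _ (by omega), Int.cast_zero]

theorem hilbSeries_seqIdeal_varSeq : hilbSeries (seqIdeal (varSeq L N) N) = 1 := by
  ext k
  rw [hilbSeries, PowerSeries.coeff_mk, PowerSeries.coeff_one]
  -- The ideal of all variables consists of the polynomials without constant term.
  have hmem : ∀ P : MvPolynomial (Fin N) L,
      P ∈ seqIdeal (varSeq L N) N ↔ ∀ m ∈ P.support, m ≠ 0 := by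
    intro P
    rw [seqIdeal_varSeq le_rfl, mem_ideal_span_X_image]
    refine forall₂_congr fun m _ => ?_
    rw [Finsupp.ne_iff]
    simp
  split_ifs with hk
  · subst hk
    have h1 : idealPart (seqIdeal (varSeq L N) N) 0 = ⊥ := by
      refine (Submodule.eq_bot_iff _).2 ?_
      rintro P ⟨hP, hP'⟩
      ext m
      by_contra h
      have h1 := mem_gr.1 hP' m h
      refine (hmem P).1 hP m (mem_support_iff.2 h) ?_
      exact (Finsupp.degree_eq_zero_iff m).1 (by exact_mod_cast h1)
    have h2 : gr L (Fin N) 0 = Submodule.span L {1} := by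
      apply le_antisymm
      · intro P hP
        rw [Submodule.mem_span_singleton]
        refine ⟨coeff 0 P, ?_⟩
        rw [← C_mul', mul_one, eq_comm, ← totalDegree_eq_zero_iff_eq_C,
          totalDegree_zero_iff_isHomogeneous]
        exact mem_gr_natCast.1 hP
      · rw [Submodule.span_singleton_le_iff_mem]
        exact isWeightedHomogeneous_one L _
    rw [Nat.cast_zero, hilb, h1, h2, finrank_span_singleton one_ne_zero]
    simp
  · have h1 : idealPart (seqIdeal (varSeq L N) N) k = gr L (Fin N) k := by
      refine inf_eq_right.2 fun P hP => (hmem P).2 ?_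
      rintro m hm rfl
      have := mem_gr.1 hP 0 (mem_support_iff.1 hm)
      simp at this
      omega
    rw [hilb, h1, sub_self, Int.cast_zero]

/-- No monomials are counted: the quotient by the regular sequence of variables is L, whose series
is 1. -/
theorem hilbSeries_bot : (1 - PowerSeries.X) ^ N *
    hilbSeries (⊥ : Ideal (MvPolynomial (Fin N) L)) = 1 := by
  have h := hilbSeries_seqIdeal (L := L) (N := N) (g := varSeq L N) (e := 1)
    (fun i hi => by exact_mod_cast varSeq_mem_gr hi)
    (fun i hi => by rw [varSeq_of_lt hi]; exact X_ne_zero _) (fun i hi => regOn_varSeq hi)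
  rw [hilbSeries_seqIdeal_varSeq, pow_one] at h
  exact h.symm

end Variables

/-! ### Koszul syzygies and Hilbert series of complete intersections. -/

section KoszulSyzygies

open MvPolynomial

theorem seqIdeal_eq_span_range {R : Type*} [CommRing R] (g : ℕ → R) (N : ℕ) :
    seqIdeal g N = Ideal.span (Set.range fun i : Fin N => g i) := by
  ext z
  rw [mem_seqIdeal, Ideal.mem_span_range_iff_exists_fun]
  constructor
  · rintro ⟨c, rfl⟩
    exact ⟨fun i => c i, (Finset.sum_range fun i => c i * g i).symm⟩
  · rintro ⟨c, rfl⟩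
    refine ⟨fun i => if h : i < N then c ⟨i, h⟩ else 0, ?_⟩
    rw [Finset.sum_range]
    simp

/-- Every syzygy of the family `f` is a combination of the Koszul syzygies. -/
def KoszulSyzygies {R ι : Type*} [CommRing R] [Fintype ι] (f : ι → R) : Prop :=
  ∀ Q : ι → R, ∑ i, Q i * f i = 0 →
    ∃ W : ι → ι → R, (∀ i j, W i j = - W j i) ∧ ∀ i, Q i = ∑ j, W i j * f j

/-- The contracting homotopy of the Koszul complex given by 1 = ∑ aⱼ fⱼ. It serves the case d = 1,
where the partials are constants. -/
theorem koszulSyzygies_of_span_eq_top {R ι : Type*} [CommRing R] [Fintype ι] {f : ι → R}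
    (h : Ideal.span (Set.range f) = ⊤) : KoszulSyzygies f := by
  intro Q hQ
  obtain ⟨a, ha⟩ := Ideal.mem_span_range_iff_exists_fun.1 ((Ideal.eq_top_iff_one _).1 h)
  refine ⟨fun i j => Q i * a j - Q j * a i, fun i j => by ring, fun i => ?_⟩
  have h1 : ∑ j, (Q i * a j - Q j * a i) * f j =
      Q i * ∑ j, a j * f j - a i * ∑ j, Q j * f j := by
    rw [Finset.mul_sum, Finset.mul_sum, ← Finset.sum_sub_distrib]
    exact Finset.sum_congr rfl fun j _ => by ring
  rw [h1, ha, hQ]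
  ring

theorem koszulSyzygies_of_regular {R : Type*} [CommRing R] {g : ℕ → R} {N : ℕ}
    (hg : ∀ i < N, RegOn (seqIdeal g i) (g i)) : KoszulSyzygies fun i : Fin N => g i := by
  intro Q hQ
  obtain ⟨W, hW, h⟩ := koszul_of_regular hg (fun i => if h : i < N then Q ⟨i, h⟩ else 0) (by
    rw [Finset.sum_range]
    simpa using hQ)
  refine ⟨fun i j => W i j, fun i j => hW i j, fun i => ?_⟩
  have := h i i.2
  rw [Finset.sum_range] at this
  simpa using this

/-- The property is invariant under an invertible linear substitution. -/
theorem KoszulSyzygies.of_matrix {R ι : Type*} [CommRing R] [Fintype ι] [DecidableEq ι]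
    {f : ι → R} {A B : Matrix ι ι R} (hBA : B * A = 1)
    (h : KoszulSyzygies (A.mulVec f)) : KoszulSyzygies f := by
  intro Q hQ
  obtain ⟨W, hW, hWQ⟩ := h (Matrix.vecMul Q B) (by
    change (Matrix.vecMul Q B) ⬝ᵥ (A.mulVec f) = 0
    rw [← Matrix.dotProduct_mulVec, Matrix.mulVec_mulVec, hBA, Matrix.one_mulVec]
    exact hQ)
  have h1 : Matrix.vecMul Q B = (Matrix.of W).mulVec (A.mulVec f) := funext hWQ
  have hWt : (Matrix.of W).transpose = - Matrix.of W := by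
    ext i j
    exact hW j i
  -- Congruence by A preserves antisymmetry and undoes the substitution.
  refine ⟨A.transpose * Matrix.of W * A, fun i j => ?_, fun i => ?_⟩
  · have : (A.transpose * Matrix.of W * A).transpose = - (A.transpose * Matrix.of W * A) := by
      rw [Matrix.transpose_mul, Matrix.transpose_mul, Matrix.transpose_transpose, hWt,
        Matrix.neg_mul, Matrix.mul_neg, Matrix.mul_assoc]
    have := congrFun (congrFun this j) i
    simpa [Matrix.transpose_apply] using this
  · have h2 : Q = (A.transpose * Matrix.of W * A).mulVec f := by
      rw [← Matrix.mulVec_mulVec, ← Matrix.mulVec_mulVec, ← h1, Matrix.mulVec_transpose,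
        Matrix.vecMul_vecMul, hBA, Matrix.vecMul_one]
    exact congrFun h2 i

variable {L : Type*} [Field L] {N : ℕ}

theorem homIdeal_span_range {f : Fin N → MvPolynomial (Fin N) L} {e : ℤ}
    (hf : ∀ i, f i ∈ gr L (Fin N) e) : HomIdeal (Ideal.span (Set.range f)) := by
  have := seqIdeal_eq_span_range (fun i => if h : i < N then f ⟨i, h⟩ else 0) N
  simp only [Fin.is_lt, dite_true, Fin.eta] at this
  rw [← this]
  refine homIdeal_seqIdeal (e := e) fun i hi => ?_
  rw [dif_pos hi]
  exact hf _

/-- The class of a variable is algebraic over L; the top component of an annihilating polynomial is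
a nonzero multiple of a power and lies in I by homogeneity. -/
theorem exists_X_pow_mem {I : Ideal (MvPolynomial (Fin N) L)} (hI : HomIdeal I)
    (hfin : FiniteDimensional L (MvPolynomial (Fin N) L ⧸ I)) (i : Fin N) :
    ∃ K : ℕ, (X i : MvPolynomial (Fin N) L) ^ K ∈ I := by
  obtain ⟨p, hp, hp'⟩ := Algebra.IsAlgebraic.isAlgebraic (R := L)
    (Ideal.Quotient.mk I (X i : MvPolynomial (Fin N) L))
  have h1 : Polynomial.aeval (X i : MvPolynomial (Fin N) L) p ∈ I := by
    rw [← Ideal.Quotient.eq_zero_iff_mem, ← hp', ← Ideal.Quotient.mkₐ_eq_mk L,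
      Polynomial.aeval_algHom_apply]
  refine ⟨p.natDegree, ?_⟩
  have h2 := hI _ h1 p.natDegree
  rw [Polynomial.aeval_eq_sum_range, map_sum, Finset.sum_eq_single p.natDegree] at h2
  · rw [map_smul, comp_self (by simpa using gr_pow (X_mem_gr i) p.natDegree)] at h2
    have h3 := I.mul_mem_left (C (p.leadingCoeff)⁻¹) h2
    rwa [Polynomial.coeff_natDegree, ← C_mul', ← mul_assoc, ← C_mul,
      inv_mul_cancel₀ (Polynomial.leadingCoeff_ne_zero.2 hp), C_1, one_mul] at h3
  · intro k _ hk
    have h : (X i : MvPolynomial (Fin N) L) ^ k ∈ gr L (Fin N) k := by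
      simpa using gr_pow (X_mem_gr i) k
    rw [map_smul, comp_of_mem h, if_neg (by exact_mod_cast hk.symm), smul_zero]
  · simp

theorem mem_span_X_of_mem_gr {e : ℤ} (he : 0 < e) {P : MvPolynomial (Fin N) L}
    (hP : P ∈ gr L (Fin N) e) :
    P ∈ Ideal.span (Set.range (X : Fin N → MvPolynomial (Fin N) L)) := by
  rw [← Set.image_univ, mem_ideal_span_X_image]
  intro m hm
  have h := mem_gr.1 hP m (mem_support_iff.1 hm)
  by_contra hcon
  push Not at hcon
  have : m = 0 := by ext i; exact hcon i trivial
  subst this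
  simp at h
  omega

theorem one_notMem_span_X : (1 : MvPolynomial (Fin N) L) ∉
    Ideal.span (Set.range (X : Fin N → MvPolynomial (Fin N) L)) := by
  rw [← Set.image_univ, mem_ideal_span_X_image]
  intro h
  obtain ⟨i, -, hi⟩ := h 0 (by simp)
  exact hi rfl

/-- A homogeneous system of parameters of the polynomial ring, up to an invertible linear
substitution, is a regular sequence. -/
theorem exists_regular_matrix [Infinite L] {f : Fin N → MvPolynomial (Fin N) L} {e : ℤ}
    (he : 0 < e) (hf : ∀ i, f i ∈ gr L (Fin N) e)
    (hfin : FiniteDimensional L (MvPolynomial (Fin N) L ⧸ Ideal.span (Set.range f))) :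
    ∃ (A : ℕ → Fin N → L) (B : Matrix (Fin N) (Fin N) L),
      B * Matrix.of (fun i : Fin N => A i) = 1 ∧
      ∀ i < N, RegOn (seqIdeal (fun l => ∑ j, A l j • f j) i) (∑ j, A i j • f j) := by
  have hfm := fun i => mem_span_X_of_mem_gr he (hf i)
  obtain ⟨A, hA⟩ := exists_regular_combinations (L := L)
    (m := Ideal.span (Set.range (X : Fin N → MvPolynomial (Fin N) L))) (f := f) (N := N) (by
      intro P hP hPf
      rw [Ideal.span_le]
      rintro _ ⟨i, rfl⟩
      obtain ⟨K, hK⟩ := exists_X_pow_mem (homIdeal_span_range hf) hfin i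
      refine hP.mem_of_pow_mem K (Ideal.span_le.2 ?_ hK)
      rintro _ ⟨j, rfl⟩
      exact hPf j) hfm
    (DepthGE.of_regular (g := varSeq L N) (fun i hi => by
      rw [varSeq_of_lt hi]; exact Ideal.subset_span ⟨_, rfl⟩) (fun i hi => regOn_varSeq hi) N 0
      (by omega))
  have hseq : ∀ r, seqIdeal (fun l => ∑ j, A l j • f j) r ≤
      Ideal.span (Set.range (X : Fin N → MvPolynomial (Fin N) L)) := fun r z hz => by
    obtain ⟨c, rfl⟩ := mem_seqIdeal.1 hz
    refine Ideal.sum_mem _ fun i _ => Ideal.mul_mem_left _ _ (Ideal.sum_mem _ fun j _ => ?_)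
    rw [Algebra.smul_def]
    exact Ideal.mul_mem_left _ _ (hfm j)
  -- A row dependent on the earlier ones would put its combination into the ideal of the earlier
  -- combinations; regularity would then put 1 there, although that ideal lies in (X).
  have hind : ∀ r ≤ N, ∀ c : ℕ → L, ∑ i ∈ Finset.range r, c i • A i = 0 → ∀ i < r, c i = 0 := by
    intro r
    induction r with
    | zero => intros; omega
    | succ r ih =>
      intro hr c hc
      rw [Finset.sum_range_succ] at hc
      have hcr : c r = 0 := by
        by_contra hcr
        have h1 : ∑ i ∈ Finset.range r, c i • ∑ j, A i j • f j + c r • ∑ j, A r j • f j = 0 := by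
          have := congrArg (Fintype.linearCombination L f) hc
          rw [map_add, map_sum, map_zero] at this
          simpa only [map_smul, Fintype.linearCombination_apply] using this
        refine one_notMem_span_X (hseq r (hA r hr 1 (mem_seqIdeal.2 ⟨fun i => C (-(c r)⁻¹ * c i), ?_⟩)))
        simp only [C_mul', mul_smul, ← Finset.smul_sum]
        rw [eq_neg_of_add_eq_zero_left h1, smul_neg, neg_smul, neg_neg, smul_smul,
          inv_mul_cancel₀ hcr, one_smul, mul_one]
      intro i hi
      rcases Nat.lt_succ_iff_lt_or_eq.1 hi with hi | rfl
      · exact ih (by omega) c (by simpa [hcr] using hc) i hi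
      · exact hcr
  have hunit : IsUnit (Matrix.of fun i : Fin N => A i) := by
    rw [← Matrix.linearIndependent_rows_iff_isUnit, Fintype.linearIndependent_iff]
    intro c hc i
    have := hind N le_rfl (fun i => if h : i < N then c ⟨i, h⟩ else 0) (by
      rw [Finset.sum_range]
      simpa using hc) i i.2
    simpa using this
  obtain ⟨B, hB⟩ := hunit.exists_left_inv
  exact ⟨A, B, hB, hA⟩

/-- For `N` forms of the same degree in `N` variables with finite-dimensional quotient, all
syzygies are Koszul, and the Hilbert series of the quotient is that of a complete intersection. -/
theorem koszul_and_hilbSeries [Infinite L] (hN : 0 < N) {f : Fin N → MvPolynomial (Fin N) L}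
    {e : ℕ} (hf : ∀ i, f i ∈ gr L (Fin N) e)
    (hfin : FiniteDimensional L (MvPolynomial (Fin N) L ⧸ Ideal.span (Set.range f))) :
    KoszulSyzygies f ∧ hilbSeries (Ideal.span (Set.range f)) = (1 - PowerSeries.X ^ e) ^ N *
      hilbSeries (⊥ : Ideal (MvPolynomial (Fin N) L)) := by
  rcases Nat.eq_zero_or_pos e with rfl | he
  -- In degree e = 0 the forms are constants. They cannot all vanish, since some power of a variable
  -- lies in their ideal.
  · have htop : Ideal.span (Set.range f) = ⊤ := by
      obtain ⟨K, hK⟩ := exists_X_pow_mem (homIdeal_span_range hf) hfin ⟨0, hN⟩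
      by_contra hne
      have hf0 : ∀ i, f i = 0 := by
        intro i
        by_contra hi
        refine hne (Ideal.eq_top_of_isUnit_mem _ (Ideal.subset_span ⟨i, rfl⟩) ?_)
        have h := mem_gr_natCast.1 (hf i)
        rw [← totalDegree_zero_iff_isHomogeneous, totalDegree_eq_zero_iff_eq_C] at h
        rw [h] at hi ⊢
        exact (isUnit_iff_ne_zero.2 fun h0 => hi (by rw [h0, C_0])).map C
      have h0 : Ideal.span (Set.range f) = ⊥ := by
        rw [Ideal.span_eq_bot]
        rintro _ ⟨i, rfl⟩
        exact hf0 i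
      rw [h0, Ideal.mem_bot] at hK
      exact pow_ne_zero K (X_ne_zero _) hK
    refine ⟨koszulSyzygies_of_span_eq_top htop, ?_⟩
    rw [pow_zero, sub_self, zero_pow hN.ne', zero_mul, htop]
    ext k
    have h1 : idealPart (⊤ : Ideal (MvPolynomial (Fin N) L)) k = gr L (Fin N) k :=
      inf_eq_right.2 fun _ _ => trivial
    rw [hilbSeries, PowerSeries.coeff_mk, hilb, h1, sub_self, Int.cast_zero, map_zero]
  · obtain ⟨A, B, hBA, hreg⟩ := exists_regular_matrix (by exact_mod_cast he) hf hfin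
    have hBA' : B.map C * (Matrix.of fun i : Fin N => A i).map C =
        (1 : Matrix (Fin N) (Fin N) (MvPolynomial (Fin N) L)) := by
      rw [← Matrix.map_mul, hBA, Matrix.map_one _ C_0 C_1]
    have hmul : ((Matrix.of fun i : Fin N => A i).map C).mulVec f =
        fun i : Fin N => ∑ j, A i j • f j := by
      ext1 i
      simp [Matrix.mulVec, dotProduct, C_mul']
    have hkos := koszulSyzygies_of_regular hreg
    rw [← hmul] at hkos
    refine ⟨hkos.of_matrix hBA', ?_⟩
    have hspan : seqIdeal (fun l => ∑ j, A l j • f j) N = Ideal.span (Set.range f) := by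
      rw [seqIdeal_eq_span_range]
      apply le_antisymm <;> rw [Ideal.span_le] <;> rintro _ ⟨i, rfl⟩
      · refine Ideal.sum_mem _ fun j _ => ?_
        rw [Algebra.smul_def]
        exact Ideal.mul_mem_left _ _ (Ideal.subset_span ⟨j, rfl⟩)
      · have h1 : f = (B.map C).mulVec fun i : Fin N => ∑ j, A i j • f j := by
          rw [← hmul, Matrix.mulVec_mulVec, hBA', Matrix.one_mulVec]
        rw [congrFun h1 i, Matrix.mulVec, dotProduct]
        refine Ideal.sum_mem _ fun l _ => Ideal.mul_mem_left _ _ (Ideal.subset_span ?_)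
        exact ⟨l, rfl⟩
    have hgr : ∀ i, ∑ j, A i j • f j ∈ gr L (Fin N) e := fun i =>
      Submodule.sum_mem _ fun j _ => Submodule.smul_mem _ _ (hf j)
    rw [← hspan]
    refine hilbSeries_seqIdeal (fun i _ => hgr i) (fun i hi h0 => ?_) hreg
    -- A zero term would be regular only modulo the unit ideal, but the earlier terms generate an
    -- ideal inside (X).
    have h1 := hreg i hi 1
    rw [h0, zero_mul] at h1
    have h2 : (seqIdeal (fun l => ∑ j, A l j • f j) i) ≤
        Ideal.span (Set.range (X : Fin N → MvPolynomial (Fin N) L)) := fun z hz => by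
      obtain ⟨c, rfl⟩ := mem_seqIdeal.1 hz
      exact Ideal.sum_mem _ fun l _ => Ideal.mul_mem_left _ _
        (mem_span_X_of_mem_gr (by exact_mod_cast he) (hgr l))
    exact one_notMem_span_X (h2 (h1 (zero_mem _)))

theorem hilbSeries_eq_geom [Infinite L] (hN : 0 < N) {f : Fin N → MvPolynomial (Fin N) L}
    {e : ℕ} (hf : ∀ i, f i ∈ gr L (Fin N) e)
    (hfin : FiniteDimensional L (MvPolynomial (Fin N) L ⧸ Ideal.span (Set.range f))) :
    hilbSeries (Ideal.span (Set.range f)) =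
      (((∑ i ∈ Finset.range e, Polynomial.X ^ i) ^ N : Polynomial ℚ) : PowerSeries ℚ) := by
  have h1 : ((∑ i ∈ Finset.range e, Polynomial.X ^ i : Polynomial ℚ) : PowerSeries ℚ) *
      (1 - PowerSeries.X) = 1 - PowerSeries.X ^ e := by
    have := congrArg (Polynomial.toPowerSeries (R := ℚ))
      (geom_sum_mul_neg (Polynomial.X : Polynomial ℚ) e)
    simpa using this
  rw [(koszul_and_hilbSeries hN hf hfin).2, ← h1, mul_pow, mul_assoc, hilbSeries_bot, mul_one,
    Polynomial.coe_pow]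

end KoszulSyzygies

/-! ### Griffiths' reduction of the pole order, for numerators. -/

section PoleReduction

open MvPolynomial

variable {L : Type*} [Field L] {N : ℕ}

theorem pderiv_comm (i j : Fin N) (P : MvPolynomial (Fin N) L) :
    pderiv i (pderiv j P) = pderiv j (pderiv i P) := by
  have h : ⁅pderiv (R := L) i, pderiv (R := L) j⁆ = 0 := by
    refine derivation_ext fun k => ?_
    simp only [Derivation.commutator_apply, pderiv_X, Derivation.zero_apply]
    rw [Pi.single_apply, Pi.single_apply]
    split_ifs <;> simp
  have := congrArg (fun D => D P) h
  simpa [Derivation.commutator_apply, sub_eq_zero] using this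

/-- Euler's identity in the integral grading. -/
theorem sum_X_mul_pderiv_of_mem_gr {p : ℤ} {P : MvPolynomial (Fin N) L}
    (hP : P ∈ gr L (Fin N) p) : ∑ i, X i * pderiv i P = (p : MvPolynomial (Fin N) L) * P := by
  rcases lt_or_ge p 0 with hp | hp
  · simp [eq_zero_of_mem_gr_neg hp hP]
  · obtain ⟨d, rfl⟩ := Int.eq_ofNat_of_zero_le hp
    rw [(mem_gr_natCast.1 hP).sum_X_mul_pderiv]
    simp

theorem sum_pderiv_X_mul {p : ℤ} {P : MvPolynomial (Fin N) L} (hP : P ∈ gr L (Fin N) p) :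
    ∑ i, pderiv i (X i * P) = ((p : MvPolynomial (Fin N) L) + (N : MvPolynomial (Fin N) L)) * P := by
  simp only [pderiv_mul, pderiv_X_self, one_mul, Finset.sum_add_distrib,
    sum_X_mul_pderiv_of_mem_gr hP]
  simp
  ring

theorem sum_antisymm_mul_symm [CharZero L] {W S : Fin N → Fin N → MvPolynomial (Fin N) L}
    (hW : ∀ i j, W i j = - W j i) (hS : ∀ i j, S i j = S j i) : ∑ i, ∑ j, W i j * S i j = 0 := by
  have h : ∑ i, ∑ j, W i j * S i j = - ∑ i, ∑ j, W i j * S i j := by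
    conv_lhs => rw [Finset.sum_comm]
    simp only [← Finset.sum_neg_distrib]
    refine Finset.sum_congr rfl fun i _ => Finset.sum_congr rfl fun j _ => ?_
    rw [hW j i, hS j i, neg_mul]
  exact self_eq_neg.1 h

theorem KoszulSyzygies.homogeneous {f : Fin N → MvPolynomial (Fin N) L} (h : KoszulSyzygies f)
    {e q : ℤ} (hf : ∀ i, f i ∈ gr L (Fin N) e) {Q : Fin N → MvPolynomial (Fin N) L}
    (hQ : ∀ i, Q i ∈ gr L (Fin N) q) (hs : ∑ i, Q i * f i = 0) :
    ∃ W : Fin N → Fin N → MvPolynomial (Fin N) L, (∀ i j, W i j ∈ gr L (Fin N) (q - e)) ∧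
      (∀ i j, W i j = - W j i) ∧ ∀ i, Q i = ∑ j, W i j * f j := by
  obtain ⟨W, hW, hQW⟩ := h Q hs
  refine ⟨fun i j => comp (q - e) (W i j), fun i j => comp_mem _ _, fun i j => ?_, fun i => ?_⟩
  · dsimp only
    rw [hW i j, map_neg]
  · rw [← comp_self (hQ i), hQW i, map_sum]
    exact Finset.sum_congr rfl fun j _ => comp_mul _ _ (hf j)

/-- The hypothesis says S / f^m = ∑ ∂ᵢ(Qᵢ / f^m). With G = S - ∑ ∂ᵢQᵢ, Euler's identity makes xᵢ G +
d m Qᵢ a syzygy of the partials, hence equal to ∑ⱼ Wᵢⱼ ∂ⱼf. Its divergence is d m S, because deg G +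
N = m d; the terms Wᵢⱼ ∂ᵢ∂ⱼf cancel by antisymmetry. So Vⱼ = ∑ᵢ ∂ᵢWᵢⱼ works, and it is
divergence-free for the same reason. -/
theorem exists_reduction [CharZero L] {f : MvPolynomial (Fin N) L} {d : ℕ}
    (hf : f ∈ gr L (Fin N) d) (hk : KoszulSyzygies fun i => pderiv i f) (m : ℕ)
    {S : MvPolynomial (Fin N) L} (hS : S ∈ gr L (Fin N) (m * d - N))
    {Q : Fin N → MvPolynomial (Fin N) L} (hQ : ∀ i, Q i ∈ gr L (Fin N) (m * d - N + 1))
    (h : f * S = ∑ i, (f * pderiv i (Q i) - (m : MvPolynomial (Fin N) L) *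
      (Q i * pderiv i f))) :
    ∃ V : Fin N → MvPolynomial (Fin N) L, (∀ i, V i ∈ gr L (Fin N) ((m - 1) * d - N + 1)) ∧
      ∑ i, pderiv i (V i) = 0 ∧
      (d : MvPolynomial (Fin N) L) * (m : MvPolynomial (Fin N) L) * S = ∑ i, V i * pderiv i f := by
  have hnat : ∀ (a : ℕ) {p : ℤ} {P : MvPolynomial (Fin N) L}, P ∈ gr L (Fin N) p →
      (a : MvPolynomial (Fin N) L) * P ∈ gr L (Fin N) p := fun a p P hP => by
    rw [← nsmul_eq_mul]; exact nsmul_mem hP a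
  set G := S - ∑ i, pderiv i (Q i) with hG
  have hGgr : G ∈ gr L (Fin N) (m * d - N) := by
    refine sub_mem hS (Submodule.sum_mem _ fun i _ => ?_)
    simpa using gr_pderiv (hQ i) i
  have hfG : f * G = - ((m : MvPolynomial (Fin N) L) * ∑ i, Q i * pderiv i f) := by
    rw [hG, mul_sub, h, Finset.sum_sub_distrib, Finset.mul_sum, Finset.mul_sum]
    ring
  have hE : ∑ i, X i * pderiv i f = (d : MvPolynomial (Fin N) L) * f := by
    simpa using sum_X_mul_pderiv_of_mem_gr hf
  have hsyz : ∑ i, (X i * G + (d : MvPolynomial (Fin N) L) * ((m : MvPolynomial (Fin N) L) * Q i)) * pderiv i f = 0 := by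
    have : ∑ i, (X i * G + (d : MvPolynomial (Fin N) L) * ((m : MvPolynomial (Fin N) L) * Q i)) * pderiv i f =
        G * ∑ i, X i * pderiv i f +
          (d : MvPolynomial (Fin N) L) * ((m : MvPolynomial (Fin N) L) * ∑ i, Q i * pderiv i f) := by
      simp only [Finset.mul_sum, ← Finset.sum_add_distrib]
      exact Finset.sum_congr rfl fun i _ => by ring
    rw [this, hE]
    linear_combination (d : MvPolynomial (Fin N) L) * hfG
  obtain ⟨W, hWgr, hW, hWQ⟩ := hk.homogeneous (fun i => gr_pderiv hf i)
    (q := m * d - N + 1) (fun i => by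
      refine add_mem ?_ (hnat _ (hnat _ (hQ i)))
      rw [add_comm]
      exact gr_mul (X_mem_gr i) hGgr) hsyz
  refine ⟨fun j => ∑ i, pderiv i (W i j), fun j => Submodule.sum_mem _ fun i _ => ?_, ?_, ?_⟩
  · have := gr_pderiv (hWgr i j) i
    convert this using 2
    ring
  · simp only [map_sum]
    have := sum_antisymm_mul_symm (L := L) (N := N) (W := fun i j => pderiv i (pderiv j (W i j)))
      (S := fun _ _ => 1) (fun i j => by rw [hW i j, map_neg, map_neg, pderiv_comm])
      (fun _ _ => rfl)
    rw [Finset.sum_comm]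
    simpa [pderiv_comm] using this
  · have h1 : ∑ i, pderiv i (X i * G + (d : MvPolynomial (Fin N) L) * ((m : MvPolynomial (Fin N) L) * Q i)) =
        (d : MvPolynomial (Fin N) L) * (m : MvPolynomial (Fin N) L) * S := by
      have hc : ∀ i, pderiv i ((d : MvPolynomial (Fin N) L) * ((m : MvPolynomial (Fin N) L) * Q i)) =
          (d : MvPolynomial (Fin N) L) * (m : MvPolynomial (Fin N) L) * pderiv i (Q i) := fun i => by
        rw [← mul_assoc, pderiv_mul]
        simp
      simp only [map_add, hc, Finset.sum_add_distrib, sum_pderiv_X_mul hGgr, ← Finset.mul_sum]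
      rw [hG]
      push_cast
      ring
    rw [← h1]
    simp only [hWQ, map_sum, pderiv_mul, Finset.sum_add_distrib]
    rw [sum_antisymm_mul_symm hW fun i j => pderiv_comm i j f, add_zero, Finset.sum_comm]
    simp only [Finset.sum_mul]

/-- Griffiths' reduction of the pole order: if a form with a pole of order `k` is exact through
forms with poles of any order, then its numerator lies in the Jacobian ideal. -/
theorem mem_span_pderiv_of_exact [CharZero L] {f : MvPolynomial (Fin N) L} {d : ℕ} (hd : 0 < d)
    (hf : f ∈ gr L (Fin N) d) (hk : KoszulSyzygies fun i => pderiv i f) (k : ℕ) (hk1 : 1 ≤ k)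
    {P : MvPolynomial (Fin N) L} (hP : P ∈ gr L (Fin N) (k * d - N)) (j : ℕ) :
    ∀ Q : Fin N → MvPolynomial (Fin N) L, (∀ i, Q i ∈ gr L (Fin N) ((k + j : ℕ) * d - N + 1)) →
      f ^ (j + 1) * P = ∑ i, (f * pderiv i (Q i) - ((k + j : ℕ) : MvPolynomial (Fin N) L) *
        (Q i * pderiv i f)) →
      P ∈ Ideal.span (Set.range fun i => pderiv i f) := by
  have hdL : (d : L) ≠ 0 := Nat.cast_ne_zero.2 hd.ne'
  induction j with
  | zero =>
    intro Q hQ h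
    obtain ⟨V, -, -, hV⟩ := exists_reduction hf hk k hP hQ (by simpa using h)
    have hkL : (k : L) ≠ 0 := Nat.cast_ne_zero.2 (by omega)
    have h1 : P = C ((d * k : L)⁻¹) * ((d : MvPolynomial (Fin N) L) * (k : MvPolynomial (Fin N) L) * P) := by
      rw [← C_eq_coe_nat, ← C_eq_coe_nat, ← C_mul, ← mul_assoc, ← C_mul,
        inv_mul_cancel₀ (mul_ne_zero hdL hkL), C_1, one_mul]
    rw [h1, hV]
    exact Ideal.mul_mem_left _ _ (Ideal.sum_mem _ fun i _ => Ideal.mul_mem_left _ _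
      (Ideal.subset_span ⟨i, rfl⟩))
  | succ j ih =>
    intro Q hQ h
    have hS : f ^ (j + 1) * P ∈ gr L (Fin N) ((k + (j + 1) : ℕ) * d - N) := by
      convert gr_mul (gr_pow hf (j + 1)) hP using 2
      push_cast
      ring
    obtain ⟨V, hVgr, hVd, hV⟩ := exists_reduction hf hk (k + (j + 1)) hS hQ (by
      rw [← h]; ring)
    have hm1 : ((k + (j + 1) : ℕ) : L) ≠ 0 := Nat.cast_ne_zero.2 (by omega)
    have hm2 : ((k + j : ℕ) : L) ≠ 0 := Nat.cast_ne_zero.2 (by omega)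
    have hc : C ((d * (k + (j + 1) : ℕ) * (k + j : ℕ) : L)⁻¹) * ((d : MvPolynomial (Fin N) L) *
        ((k + (j + 1) : ℕ) : MvPolynomial (Fin N) L) *
        ((k + j : ℕ) : MvPolynomial (Fin N) L)) = 1 := by
      rw [← C_eq_coe_nat, ← C_eq_coe_nat, ← C_eq_coe_nat, ← C_mul, ← C_mul, ← C_mul,
        inv_mul_cancel₀ (mul_ne_zero (mul_ne_zero hdL hm1) hm2), C_1]
    generalize (d * (k + (j + 1) : ℕ) * (k + j : ℕ) : L)⁻¹ = c at hc
    -- As V is divergence-free, only the term with ∂ᵢf survives in the derivative of -cV / f^(k+j).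
    -- The constant c = 1/(d(k+j+1)(k+j)) makes it the original form, with primitives of pole order
    -- one less.
    refine ih (fun i => C (-c) * V i) (fun i => ?_) ?_
    · rw [C_mul']
      refine Submodule.smul_mem _ _ ?_
      convert hVgr i using 2
      push_cast
      ring
    · have h2 : ∀ i, pderiv i (C (-c) * V i) = C (-c) * pderiv i (V i) := fun i => pderiv_C_mul
      simp only [h2, Finset.sum_sub_distrib, ← Finset.mul_sum, hVd, mul_assoc]
      rw [← hV, C_neg]
      linear_combination (- f ^ (j + 1) * P) * hc

end PoleReduction

/-! ### Rational functions as fractions P / f^k. -/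

section RationalFunctions

open MvPolynomial

variable {L : Type*} [Field L] {n : ℕ}

theorem scale_monomial (c : Lˣ) (m : Fin (n + 1) →₀ ℕ) (a : L) :
    scale c (monomial m a) = (c : L) ^ m.degree • monomial m a := by
  rw [scale, aeval_monomial, monomial_eq, Finsupp.degree_apply]
  simp only [mul_pow, Finsupp.prod, Finset.prod_mul_distrib, Finset.prod_pow_eq_pow_sum,
    algebraMap_eq, smul_eq_C_mul, C_pow]
  ring

theorem coeff_scale (c : Lˣ) (P : MvPolynomial (Fin (n + 1)) L) (m : Fin (n + 1) →₀ ℕ) :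
    coeff m (scale c P) = (c : L) ^ m.degree * coeff m P := by
  induction P using MvPolynomial.induction_on' with
  | monomial s a =>
    rw [scale_monomial, coeff_smul, coeff_monomial, smul_eq_mul]
    split_ifs with h
    · rw [h]
    · simp
  | add P Q hP hQ => rw [map_add, coeff_add, hP, hQ, coeff_add, mul_add]

theorem scale_of_mem_gr (c : Lˣ) {p : ℤ} {P : MvPolynomial (Fin (n + 1)) L}
    (hP : P ∈ gr L (Fin (n + 1)) p) : scale c P = (c : L) ^ p • P := by
  ext m
  rw [coeff_scale, coeff_smul, smul_eq_mul]
  by_cases h : coeff m P = 0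
  · simp [h]
  · rw [← mem_gr.1 hP m h, zpow_natCast]

theorem two_zpow_injective [CharZero L] : Function.Injective fun p : ℤ => (2 : L) ^ p := by
  intro p q h
  have h1 : ((2 : ℚ) ^ p : ℚ) = (2 : ℚ) ^ q := by
    have : (((2 : ℚ) ^ p : ℚ) : L) = (((2 : ℚ) ^ q : ℚ) : L) := by
      push_cast
      exact h
    exact_mod_cast this
  exact zpow_right_injective₀ (by norm_num) (by norm_num) h1

/-- Scaling by 2 alone detects the degree, since the powers of 2 are distinct in characteristic
zero. -/
theorem mem_gr_of_scale [CharZero L] {p : ℤ} {P : MvPolynomial (Fin (n + 1)) L}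
    (h : ∀ c : Lˣ, scale c P = (c : L) ^ p • P) : P ∈ gr L (Fin (n + 1)) p := by
  rw [mem_gr]
  intro m hm
  have h1 := congrArg (coeff m) (h (Units.mk0 2 two_ne_zero))
  rw [coeff_scale, coeff_smul, smul_eq_mul, Units.val_mk0] at h1
  have h2 := mul_right_cancel₀ hm h1
  exact two_zpow_injective (L := L) (by simpa using h2)

/-- The linear map `P ↦ P / f ^ k`. -/
def fracMap (f : MvPolynomial (Fin (n + 1)) L) (k : ℕ) :
    MvPolynomial (Fin (n + 1)) L →ₗ[L] RatField L n where
  toFun P := algebraMap _ (RatField L n) P / (algebraMap _ (RatField L n) f) ^ k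
  map_add' P Q := by rw [map_add, add_div]
  map_smul' c P := (smul_frac c P _).symm

theorem fracMap_apply (f : MvPolynomial (Fin (n + 1)) L) (k : ℕ)
    (P : MvPolynomial (Fin (n + 1)) L) : fracMap f k P =
      algebraMap _ (RatField L n) P / (algebraMap _ (RatField L n) f) ^ k := rfl

theorem algebraMap_ne_zero {f : MvPolynomial (Fin (n + 1)) L} (hf : f ≠ 0) :
    algebraMap _ (RatField L n) f ≠ 0 := by
  rwa [Ne, map_eq_zero_iff _ (IsFractionRing.injective (MvPolynomial (Fin (n + 1)) L)
    (RatField L n))]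

theorem fracMap_injective {f : MvPolynomial (Fin (n + 1)) L} (hf : f ≠ 0) (k : ℕ) :
    Function.Injective (fracMap f k) := by
  intro P Q h
  rw [fracMap_apply, fracMap_apply, div_left_inj' (pow_ne_zero _ (algebraMap_ne_zero hf))] at h
  exact IsFractionRing.injective (MvPolynomial (Fin (n + 1)) L) (RatField L n) h

theorem fracMap_add_pow_mul {f : MvPolynomial (Fin (n + 1)) L} (hf : f ≠ 0) (k j : ℕ)
    (P : MvPolynomial (Fin (n + 1)) L) : fracMap f (k + j) (f ^ j * P) = fracMap f k P := by
  have := algebraMap_ne_zero hf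
  rw [fracMap_apply, fracMap_apply, map_mul, map_pow, pow_add]
  field_simp

theorem fracMap_succ_mul {f : MvPolynomial (Fin (n + 1)) L} (hf : f ≠ 0) (k : ℕ)
    (P : MvPolynomial (Fin (n + 1)) L) : fracMap f (k + 1) (f * P) = fracMap f k P := by
  simpa using fracMap_add_pow_mul hf k 1 P

theorem ratPderiv_fracMap {f : MvPolynomial (Fin (n + 1)) L} (hf : f ≠ 0) (k : ℕ)
    (i : Fin (n + 1)) (P : MvPolynomial (Fin (n + 1)) L) :
    ratPderiv L i (fracMap f k P) = fracMap f (k + 1)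
      (f * pderiv i P - (k : MvPolynomial (Fin (n + 1)) L) * (P * pderiv i f)) := by
  have hf' := algebraMap_ne_zero hf
  have h : ratPderiv L i (fracMap f k P) = algebraMap _ (RatField L n)
      (pderiv i P * f ^ k - P * pderiv i (f ^ k)) /
        (algebraMap _ (RatField L n) (f ^ k)) ^ 2 := by
    rw [fracMap_apply, ← map_pow]
    exact ratPderivFun_div i P (f ^ k) (pow_ne_zero _ hf)
  rw [h, fracMap_apply, ← map_pow, ← map_pow, div_eq_div_iff
    (by rw [map_pow, map_pow]; exact pow_ne_zero _ (pow_ne_zero _ hf'))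
    (by rw [map_pow]; exact pow_ne_zero _ hf'), ← map_mul, ← map_mul]
  congr 1
  rw [pderiv_pow]
  -- The derivative of f^k involves the truncated exponent k - 1, so k = 0 is separate.
  rcases k with _ | k
  · simp; ring
  · rw [Nat.add_sub_cancel]; ring

theorem ratScale_fracMap (c : Lˣ) {f : MvPolynomial (Fin (n + 1)) L} {d : ℕ}
    (hfd : f ∈ gr L (Fin (n + 1)) d) (k : ℕ) (P : MvPolynomial (Fin (n + 1)) L) :
    ratScale c (fracMap f k P) = ((c : L) ^ (d * k))⁻¹ • fracMap f k (scale c P) := by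
  rw [fracMap_apply, map_div₀, map_pow, ratScale_algebraMap, ratScale_algebraMap,
    scale_of_mem_gr c hfd, fracMap_apply, zpow_natCast, ← map_pow, smul_pow, ← pow_mul,
    ← IsScalarTower.coe_toAlgHom' L (MvPolynomial (Fin (n + 1)) L) (RatField L n), map_smul,
    div_eq_mul_inv, smul_inv₀, mul_smul_comm, ← div_eq_mul_inv, map_pow]

theorem fracMap_mem_homogPart {f : MvPolynomial (Fin (n + 1)) L} {d : ℕ}
    (hfd : f ∈ gr L (Fin (n + 1)) d) {k : ℕ} {p : ℤ} {P : MvPolynomial (Fin (n + 1)) L}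
    (hP : P ∈ gr L (Fin (n + 1)) (k * d + p)) : fracMap f k P ∈ homogPart f p := by
  refine ⟨⟨P, k, rfl⟩, fun c => ?_⟩
  rw [ratScale_fracMap c hfd, scale_of_mem_gr c hP, map_smul, smul_smul]
  congr 1
  rw [zpow_add₀ c.ne_zero, ← mul_assoc]
  have : (c : L) ^ ((k : ℤ) * d) = (c : L) ^ (d * k) := by
    rw [← zpow_natCast]; push_cast; ring_nf
  rw [this, inv_mul_cancel₀ (pow_ne_zero _ c.ne_zero), one_mul]

/-- Allowing every k from some bound on makes it possible to put several elements over the same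
power of f. -/
theorem exists_fracMap_of_mem_homogPart [CharZero L] {f : MvPolynomial (Fin (n + 1)) L} {d : ℕ}
    (hfd : f ∈ gr L (Fin (n + 1)) d) (hf : f ≠ 0) {p : ℤ} {F : RatField L n}
    (hF : F ∈ homogPart f p) :
    ∃ k₀ : ℕ, ∀ k, k₀ ≤ k → ∃ P ∈ gr L (Fin (n + 1)) (k * d + p), F = fracMap f k P := by
  obtain ⟨⟨a, k₀, rfl⟩, hs⟩ := hF
  refine ⟨k₀, fun k hk => ?_⟩
  obtain ⟨j, rfl⟩ := Nat.exists_eq_add_of_le hk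
  rw [← fracMap_apply] at hs ⊢
  refine ⟨f ^ j * a, ?_, (fracMap_add_pow_mul hf k₀ j a).symm⟩
  have ha : a ∈ gr L (Fin (n + 1)) (k₀ * d + p) := by
    refine mem_gr_of_scale fun c => ?_
    have h := hs c
    rw [ratScale_fracMap c hfd, ← map_smul (fracMap f k₀), ← map_smul (fracMap f k₀) ((c : L) ^ p)] at h
    have h1 := congrArg (fun z => (c : L) ^ (d * k₀) • z) (fracMap_injective hf k₀ h)
    simp only [smul_smul, mul_inv_cancel₀ (pow_ne_zero _ c.ne_zero), one_smul] at h1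
    rw [h1, zpow_add₀ c.ne_zero]
    congr 2
    rw [← zpow_natCast]; push_cast; ring_nf
  convert gr_mul (gr_pow hfd j) ha using 2
  push_cast
  ring

/-- The numerators `P` of the given degree for which `P / f ^ k` lies in `D_f`. -/
def exactNum (f : MvPolynomial (Fin (n + 1)) L) (d k : ℕ) :
    Submodule L (MvPolynomial (Fin (n + 1)) L) :=
  (exactPart f).comap (fracMap f k) ⊓ gr L (Fin (n + 1)) (k * d - (n + 1 : ℕ))

theorem exactNum_le_jacobianIdeal [CharZero L] {f : MvPolynomial (Fin (n + 1)) L} {d : ℕ}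
    (hd : 0 < d) (hfd : f ∈ gr L (Fin (n + 1)) d) (hf : f ≠ 0)
    (hk : KoszulSyzygies fun i => pderiv i f) {k : ℕ} (hk1 : 1 ≤ k)
    {P : MvPolynomial (Fin (n + 1)) L} (hP : P ∈ exactNum f d k) : P ∈ jacobianIdeal f := by
  obtain ⟨⟨A, hA, hPA⟩, hPgr⟩ := hP
  choose k₀ hk₀ using fun i => exists_fracMap_of_mem_homogPart hfd hf (hA i)
  -- The sum of the pole bounds serves as a common bound for all the primitives.
  have hle : ∀ i, k₀ i ≤ k + ∑ i, k₀ i := fun i =>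
    (Finset.single_le_sum (fun _ _ => Nat.zero_le _) (Finset.mem_univ i)).trans
      (Nat.le_add_left _ _)
  choose Q hQgr hQA using fun i => hk₀ i _ (hle i)
  generalize ∑ i, k₀ i = j at hle Q hQgr hQA
  refine mem_span_pderiv_of_exact hd hfd hk k hk1 hPgr j Q (fun i => ?_) ?_
  · convert hQgr i using 2
    push_cast
    ring
  · apply fracMap_injective hf (k + (j + 1))
    rw [fracMap_add_pow_mul hf, hPA, map_sum]
    exact Finset.sum_congr rfl fun i _ => by rw [hQA i, ratPderiv_fracMap hf]; rfl

theorem self_mem_jacobianIdeal [CharZero L] {f : MvPolynomial (Fin (n + 1)) L} {d : ℕ}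
    (hd : 0 < d) (hfd : f ∈ gr L (Fin (n + 1)) d) : f ∈ jacobianIdeal f := by
  have hE : ∑ i, X i * pderiv i f = (d : MvPolynomial (Fin (n + 1)) L) * f := by
    simpa using sum_X_mul_pderiv_of_mem_gr hfd
  have h1 : f = C ((d : L)⁻¹) * ∑ i, X i * pderiv i f := by
    rw [hE, ← C_eq_coe_nat, ← mul_assoc, ← C_mul,
      inv_mul_cancel₀ (Nat.cast_ne_zero.2 hd.ne'), C_1, one_mul]
  have h2 : C ((d : L)⁻¹) * ∑ i, X i * pderiv i f ∈ jacobianIdeal f := Ideal.mul_mem_left _ _ (Ideal.sum_mem _ fun i _ => Ideal.mul_mem_left _ _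
    (Ideal.subset_span ⟨i, rfl⟩))
  rwa [← h1] at h2

end RationalFunctions

/-! ### The pole filtration and the dimension as a sum of Hilbert function values. -/

section Dimension

open MvPolynomial

variable {L : Type*} [Field L] {n : ℕ}

/-- Exact forms with a pole of order `k + 1` whose primitives have a pole of order `k`. -/
theorem exact_mem_exactNum {f : MvPolynomial (Fin (n + 1)) L} {d : ℕ}
    (hfd : f ∈ gr L (Fin (n + 1)) d) (hf : f ≠ 0) {k : ℕ}
    {Q : Fin (n + 1) → MvPolynomial (Fin (n + 1)) L}
    (hQ : ∀ i, Q i ∈ gr L (Fin (n + 1)) (k * d + -(n : ℤ))) :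
    ∑ i, (f * pderiv i (Q i) - (k : MvPolynomial (Fin (n + 1)) L) * (Q i * pderiv i f)) ∈
      exactNum f d (k + 1) := by
  constructor
  · refine ⟨fun i => fracMap f k (Q i), fun i => fracMap_mem_homogPart hfd (hQ i), ?_⟩
    rw [map_sum]
    exact Finset.sum_congr rfl fun i _ => (ratPderiv_fracMap hf k i (Q i)).symm
  · refine (gr L (Fin (n + 1)) _).sum_mem fun i _ => sub_mem ?_ ?_
    · convert gr_mul hfd (gr_pderiv (hQ i) i) using 2
      push_cast
      ring
    · rw [← nsmul_eq_mul k (Q i * pderiv i f)]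
      refine nsmul_mem ?_ k
      convert gr_mul (hQ i) (gr_pderiv hfd i) using 2
      push_cast
      ring

theorem exists_homogeneous_coeffs {f : MvPolynomial (Fin (n + 1)) L} {d : ℕ}
    (hfd : f ∈ gr L (Fin (n + 1)) d) {p : ℤ} {P : MvPolynomial (Fin (n + 1)) L}
    (hP : P ∈ idealPart (jacobianIdeal f) p) :
    ∃ Q : Fin (n + 1) → MvPolynomial (Fin (n + 1)) L,
      (∀ i, Q i ∈ gr L (Fin (n + 1)) (p - (d - 1))) ∧ P = ∑ i, Q i * pderiv i f := by
  obtain ⟨hPJ, hPp⟩ := hP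
  obtain ⟨a, ha⟩ := Ideal.mem_span_range_iff_exists_fun.1 hPJ
  refine ⟨fun i => comp (p - (d - 1)) (a i), fun i => comp_mem _ _, ?_⟩
  rw [← comp_self hPp, ← ha, map_sum]
  exact Finset.sum_congr rfl fun i _ => comp_mul _ _ (gr_pderiv hfd i)

/-- For k > 0, ∑ Qᵢ ∂ᵢf is -1/k times an exact numerator plus f times (1/k) ∑ ∂ᵢQᵢ. Conversely,
exact numerators lie in J by Griffiths' reduction and f does by Euler's identity. -/
theorem idealPart_jacobianIdeal_succ [CharZero L] (hn : 1 ≤ n)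
    {f : MvPolynomial (Fin (n + 1)) L} {d : ℕ} (hd : 0 < d) (hfd : f ∈ gr L (Fin (n + 1)) d)
    (hf : f ≠ 0) (hk : KoszulSyzygies fun i => pderiv i f) (k : ℕ) :
    idealPart (jacobianIdeal f) ((k + 1 : ℕ) * d - (n + 1 : ℕ)) = exactNum f d (k + 1) ⊔
      (gr L (Fin (n + 1)) (k * d - (n + 1 : ℕ))).map (LinearMap.mulLeft L f) := by
  apply le_antisymm
  · intro P hP
    obtain ⟨Q, hQ, rfl⟩ := exists_homogeneous_coeffs hfd hP
    have hQ' : ∀ i, Q i ∈ gr L (Fin (n + 1)) (k * d + -(n : ℤ)) := fun i => by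
      convert hQ i using 2
      push_cast
      ring
    rcases Nat.eq_zero_or_pos k with rfl | hk0
    -- The coefficients have degree -n, which is negative because n ≥ 1.
    · have h0 : ∀ i, Q i = 0 := fun i => eq_zero_of_mem_gr_neg (by push_cast; omega) (hQ' i)
      simp [h0]
    · have hkL : (k : L) ≠ 0 := Nat.cast_ne_zero.2 hk0.ne'
      have hc : C ((k : L)⁻¹) * (k : MvPolynomial (Fin (n + 1)) L) = 1 := by
        rw [← C_eq_coe_nat, ← C_mul, inv_mul_cancel₀ hkL, C_1]
      refine Submodule.mem_sup.2 ⟨_, Submodule.smul_mem _ (-(k : L)⁻¹)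
        (exact_mem_exactNum hfd hf hQ'), _, ⟨(k : L)⁻¹ • ∑ i, pderiv i (Q i),
          Submodule.smul_mem _ _ (Submodule.sum_mem _ fun i _ => ?_), rfl⟩, ?_⟩
      · convert gr_pderiv (hQ' i) i using 2
        push_cast
        ring
      · rw [LinearMap.mulLeft_apply, smul_eq_C_mul, smul_eq_C_mul, C_neg,
          Finset.sum_sub_distrib, ← Finset.mul_sum, ← Finset.mul_sum]
        linear_combination (∑ i, Q i * pderiv i f) * hc
  · refine sup_le (fun P hP => ⟨exactNum_le_jacobianIdeal hd hfd hf hk (by omega) hP, hP.2⟩) ?_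
    rintro _ ⟨P, hP, rfl⟩
    refine ⟨Ideal.mul_mem_right _ _ (self_mem_jacobianIdeal hd hfd), ?_⟩
    change f * P ∈ gr L (Fin (n + 1)) _
    convert gr_mul hfd hP using 2
    push_cast
    ring

theorem exactNum_succ_inf {f : MvPolynomial (Fin (n + 1)) L} {d : ℕ}
    (hfd : f ∈ gr L (Fin (n + 1)) d) (hf : f ≠ 0) (k : ℕ) :
    exactNum f d (k + 1) ⊓
      (gr L (Fin (n + 1)) (k * d - (n + 1 : ℕ))).map (LinearMap.mulLeft L f) =
      (exactNum f d k).map (LinearMap.mulLeft L f) := by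
  apply le_antisymm
  · rintro _ ⟨⟨hP, -⟩, P, hP', rfl⟩
    refine ⟨P, ⟨?_, hP'⟩, rfl⟩
    rw [SetLike.mem_coe, Submodule.mem_comap, LinearMap.mulLeft_apply,
      fracMap_succ_mul hf] at hP
    exact hP
  · rintro _ ⟨P, ⟨hP, hP'⟩, rfl⟩
    refine ⟨⟨?_, ?_⟩, P, hP', rfl⟩
    · rw [SetLike.mem_coe, Submodule.mem_comap, LinearMap.mulLeft_apply, fracMap_succ_mul hf]
      exact hP
    · change f * P ∈ gr L (Fin (n + 1)) _
      convert gr_mul hfd hP' using 2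
      push_cast
      ring

/-- Telescoping over the pole order: the dimension formula for the sum in
`idealPart_jacobianIdeal_succ` and the intersection in `exactNum_succ_inf` shows that step k
contributes the degree kd - n - 1 part of L[x]/J. -/
theorem finrank_sub_exactNum [CharZero L] (hn : 1 ≤ n)
    {f : MvPolynomial (Fin (n + 1)) L} {d : ℕ} (hd : 0 < d) (hfd : f ∈ gr L (Fin (n + 1)) d)
    (hf : f ≠ 0) (hk : KoszulSyzygies fun i => pderiv i f) (T : ℕ) :
    (Module.finrank L (gr L (Fin (n + 1)) (T * d - (n + 1 : ℕ))) : ℤ) -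
      Module.finrank L (exactNum f d T) =
      ∑ k ∈ Finset.range (T + 1), hilb (jacobianIdeal f) (k * d - (n + 1 : ℕ)) := by
  induction T with
  | zero =>
    have hneg : ((0 : ℕ) : ℤ) * d - (n + 1 : ℕ) < 0 := by push_cast; omega
    have h1 : exactNum f d 0 = ⊥ := by rw [exactNum, gr_neg hneg, inf_bot_eq]
    rw [h1, gr_neg hneg, Finset.sum_range_one, hilb_neg _ hneg, sub_self]
  | succ T ih =>
    rw [Finset.sum_range_succ, ← ih, hilb, idealPart_jacobianIdeal_succ hn hd hfd hf hk]
    have hinj : Function.Injective (LinearMap.mulLeft L f) := mul_right_injective₀ hf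
    have : FiniteDimensional L (exactNum f d (T + 1)) :=
      Submodule.finiteDimensional_of_le (S₂ := gr L (Fin (n + 1)) ((T + 1 : ℕ) * d - (n + 1 : ℕ)))
        inf_le_right
    have h3 := Submodule.finrank_sup_add_finrank_inf_eq (exactNum f d (T + 1))
      ((gr L (Fin (n + 1)) (T * d - (n + 1 : ℕ))).map (LinearMap.mulLeft L f))
    rw [exactNum_succ_inf hfd hf, finrank_map_of_injective hinj,
      finrank_map_of_injective hinj] at h3
    omega

/-- If all forms of large degree lie in the Jacobian ideal, then poles of order greater than `T`
can be reduced. -/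
theorem exists_reduced [CharZero L] (hn : 1 ≤ n)
    {f : MvPolynomial (Fin (n + 1)) L} {d : ℕ} (hd : 0 < d) (hfd : f ∈ gr L (Fin (n + 1)) d)
    (hf : f ≠ 0) (hk : KoszulSyzygies fun i => pderiv i f) {T : ℕ}
    (hT : ∀ k, T < k → gr L (Fin (n + 1)) (k * d - (n + 1 : ℕ)) ≤
      (jacobianIdeal f).restrictScalars L) (j : ℕ) :
    ∀ P ∈ gr L (Fin (n + 1)) ((T + j : ℕ) * d - (n + 1 : ℕ)),
      ∃ P' ∈ gr L (Fin (n + 1)) (T * d - (n + 1 : ℕ)),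
        fracMap f (T + j) P - fracMap f T P' ∈ exactPart f := by
  induction j with
  | zero => exact fun P hP => ⟨P, hP, by simp⟩
  | succ j ih =>
    intro P hP
    have h1 : P ∈ idealPart (jacobianIdeal f) ((T + j + 1 : ℕ) * d - (n + 1 : ℕ)) :=
      ⟨hT _ (by omega) hP, hP⟩
    rw [idealPart_jacobianIdeal_succ hn hd hfd hf hk] at h1
    obtain ⟨A, hA, _, ⟨B, hB, rfl⟩, rfl⟩ := Submodule.mem_sup.1 h1
    obtain ⟨P', hP', hBP⟩ := ih B hB
    refine ⟨P', hP', ?_⟩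
    rw [LinearMap.mulLeft_apply, ← add_assoc, map_add, fracMap_succ_mul hf, add_sub_assoc]
    exact add_mem hA.1 hBP

/-- Numerators over f^T surject onto the quotient, since higher poles reduce to order T; the kernel
is `exactNum f d T`. -/
theorem finrank_Hpr [CharZero L] (hn : 1 ≤ n)
    {f : MvPolynomial (Fin (n + 1)) L} {d : ℕ} (hd : 0 < d) (hfd : f ∈ gr L (Fin (n + 1)) d)
    (hf : f ≠ 0) (hk : KoszulSyzygies fun i => pderiv i f) {T : ℕ}
    (hT : ∀ k, T < k → gr L (Fin (n + 1)) (k * d - (n + 1 : ℕ)) ≤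
      (jacobianIdeal f).restrictScalars L) :
    FiniteDimensional L (Hpr f) ∧ (Module.finrank L (Hpr f) : ℤ) =
      ∑ k ∈ Finset.range (T + 1), hilb (jacobianIdeal f) (k * d - (n + 1 : ℕ)) := by
  have hdeg : ∀ k : ℕ, (k : ℤ) * d - (n + 1 : ℕ) = k * d + (-(n : ℤ) - 1) := fun k => by
    push_cast; ring
  let φ : gr L (Fin (n + 1)) (T * d - (n + 1 : ℕ)) →ₗ[L] homogPart f (-(n : ℤ) - 1) :=
    ((fracMap f T).domRestrict _).codRestrict _ fun P =>
      fracMap_mem_homogPart hfd (hdeg T ▸ P.2)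
  let ψ : gr L (Fin (n + 1)) (T * d - (n + 1 : ℕ)) →ₗ[L] Hpr f := (Submodule.mkQ _).comp φ
  have hsurj : Function.Surjective ψ := by
    intro F
    obtain ⟨⟨F, hF⟩, rfl⟩ := Submodule.mkQ_surjective _ F
    obtain ⟨k₀, hk₀⟩ := exists_fracMap_of_mem_homogPart hfd hf hF
    obtain ⟨P, hP, hPF⟩ := hk₀ (T + k₀) (Nat.le_add_left _ _)
    obtain ⟨P', hP', h⟩ := exists_reduced hn hd hfd hf hk hT k₀ P (by rw [hdeg]; exact hP)
    refine ⟨⟨P', hP'⟩, ?_⟩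
    refine (Submodule.Quotient.eq _).2 (Submodule.mem_comap.2 ?_)
    rw [← hPF] at h
    rw [← neg_mem_iff] at h
    simpa [φ] using h
  have hker : (LinearMap.ker ψ).map (Submodule.subtype _) = exactNum f d T := by
    ext P
    constructor
    · rintro ⟨P, hP, rfl⟩
      have h := (Submodule.Quotient.mk_eq_zero _).1 (LinearMap.mem_ker.1 hP)
      exact ⟨h, P.2⟩
    · rintro ⟨hP, hP'⟩
      exact ⟨⟨P, hP'⟩, LinearMap.mem_ker.2 ((Submodule.Quotient.mk_eq_zero _).2 hP), rfl⟩
  refine ⟨Module.Finite.of_surjective ψ hsurj, ?_⟩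
  rw [← finrank_sub_exactNum hn hd hfd hf hk, ← hker,
    finrank_map_of_injective (Submodule.subtype_injective _),
    ← LinearMap.finrank_range_add_finrank_ker ψ, LinearMap.range_eq_top.2 hsurj, finrank_top]
  push_cast
  ring

end Dimension

/-! ### Sums of coefficients at multiples of d. -/

section Counting

open Polynomial

/-- The sum of the coefficients whose index is a multiple of `d`. -/
def multSum (d : ℕ) : ℚ[X] →ₗ[ℚ] ℚ :=
  Polynomial.lsum fun i => if d ∣ i then LinearMap.id else 0

theorem multSum_X_pow (d i : ℕ) : multSum d (X ^ i) = if d ∣ i then 1 else 0 := by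
  rw [multSum, Polynomial.lsum_apply, ← monomial_one_right_eq_X_pow, sum_monomial_index]
  · split_ifs <;> rfl
  · split_ifs <;> rfl

theorem multSum_eq_sum {d : ℕ} (hd : 0 < d) (q : ℚ[X]) {T : ℕ} (hT : q.natDegree < d * (T + 1)) :
    multSum d q = ∑ k ∈ Finset.range (T + 1), q.coeff (k * d) := by
  rw [multSum, Polynomial.lsum_apply, Polynomial.sum_over_range' _ _ _ hT]
  · have h : ∀ i, (if d ∣ i then LinearMap.id else 0 : ℚ →ₗ[ℚ] ℚ) (q.coeff i) =
        if d ∣ i then q.coeff i else 0 := fun i => by split_ifs <;> rfl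
    simp only [h]
    rw [← Finset.sum_filter]
    refine (Finset.sum_bij (fun k _ => k * d) ?_ ?_ ?_ fun _ _ => rfl).symm
    · intro k hk
      rw [Finset.mem_range] at hk
      rw [Finset.mem_filter, Finset.mem_range, mul_comm k d]
      exact ⟨Nat.mul_lt_mul_of_pos_left hk hd, dvd_mul_right _ _⟩
    · intro a _ b _ h
      exact Nat.eq_of_mul_eq_mul_right hd h
    · rintro i hi
      rw [Finset.mem_filter, Finset.mem_range] at hi
      obtain ⟨hi, k, rfl⟩ := hi
      exact ⟨k, Finset.mem_range.2 (Nat.lt_of_mul_lt_mul_left hi), mul_comm _ _⟩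
  · intro i
    split_ifs <;> rfl

/-- Exactly one of m, …, m + d - 1 is divisible by d, so every coefficient of q is counted once. -/
theorem multSum_mul_geom {d : ℕ} (hd : 0 < d) (q : ℚ[X]) :
    multSum d (q * ∑ i ∈ Finset.range d, X ^ i) = q.eval 1 := by
  induction q using Polynomial.induction_on' with
  | add p q hp hq => rw [add_mul, map_add, hp, hq, eval_add]
  | monomial m a =>
    have h : (monomial m a : ℚ[X]) * ∑ i ∈ Finset.range d, X ^ i =
        a • ∑ i ∈ Finset.range d, X ^ (m + i) := by
      rw [← smul_X_eq_monomial, smul_mul_assoc, Finset.mul_sum]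
      simp only [pow_add]
    rw [h, map_smul, map_sum]
    simp only [multSum_X_pow]
    rw [Finset.sum_boole, eval_monomial, one_pow, mul_one, smul_eq_mul]
    have : Finset.card {i ∈ Finset.range d | d ∣ m + i} = 1 := by
      rw [Finset.card_eq_one]
      -- The outer remainder covers d ∣ m, where the index is 0 and not d.
      refine ⟨(d - m % d) % d, ?_⟩
      ext i
      rw [Finset.mem_filter, Finset.mem_range, Finset.mem_singleton]
      have hr := Nat.mod_lt m hd
      have hdvd : d ∣ m + i ↔ d ∣ m % d + i := by
        rw [Nat.dvd_iff_mod_eq_zero, Nat.dvd_iff_mod_eq_zero, Nat.mod_add_mod]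
      rw [hdvd]
      rcases Nat.eq_zero_or_pos (m % d) with h0 | h0
      · rw [h0, zero_add, Nat.sub_zero, Nat.mod_self]
        exact ⟨fun h => Nat.eq_zero_of_dvd_of_lt h.2 h.1, fun h => h ▸ ⟨hd, dvd_zero _⟩⟩
      · rw [Nat.mod_eq_of_lt (show d - m % d < d by omega)]
        constructor
        · rintro ⟨hi, c, hc⟩
          have hc1 : c = 1 := by
            have h1 : d * c < d * 2 := by omega
            have h2 : c < 2 := Nat.lt_of_mul_lt_mul_left h1
            rcases Nat.eq_zero_or_pos c with rfl | h3
            · omega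
            · omega
          rw [hc1] at hc
          omega
        · rintro rfl
          exact ⟨by omega, 1, by omega⟩
    rw [this, Nat.cast_one, mul_one]

/-- Writing one factor as (1 + X + ⋯ + X^e) - 1 gives the recursion s_(N+1) = e^N - s_N. -/
theorem multSum_pow {e : ℕ} (N : ℕ) :
    multSum (e + 1) ((X * ∑ i ∈ Finset.range e, X ^ i) ^ N) =
      1 / ((e + 1 : ℕ) : ℚ) * ((e : ℚ) ^ N + (-1) ^ N * e) := by
  have he : ((e + 1 : ℕ) : ℚ) ≠ 0 := by positivity
  induction N with
  | zero =>
    have := multSum_X_pow (e + 1) 0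
    rw [pow_zero] at this ⊢
    rw [this, if_pos (dvd_zero _)]
    field_simp
    push_cast
    ring
  | succ N ih =>
    have h1 : (X * ∑ i ∈ Finset.range e, X ^ i : ℚ[X]) =
        ∑ i ∈ Finset.range (e + 1), X ^ i - 1 := by
      rw [Finset.sum_range_succ', Finset.mul_sum]
      simp [pow_succ']
    have h2 := multSum_mul_geom (Nat.succ_pos e) ((X * ∑ i ∈ Finset.range e, X ^ i : ℚ[X]) ^ N)
    have h3 : ((X * ∑ i ∈ Finset.range e, X ^ i : ℚ[X]) ^ N).eval 1 = (e : ℚ) ^ N := by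
      simp [eval_finsetSum]
    rw [pow_succ]
    nth_rewrite 2 [h1]
    rw [mul_sub, mul_one, map_sub, h2, h3, ih]
    field_simp
    push_cast
    ring

end Counting

/-- With e = d - 1: e^(n+1) + e = e(e^n + 1) ≤ e(e+1)^n ≤ (e+1)^(n+1). -/
theorem dim_le_pow {n d : ℕ} (hn : 1 ≤ n) (hd : 0 < d) {h : ℕ}
    (hh : (h : ℚ) = 1 / (d : ℚ) * (((d : ℚ) - 1) ^ (n + 1) + (-1) ^ (n + 1) * ((d : ℚ) - 1))) :
    h ≤ d ^ n := by
  obtain ⟨e, rfl⟩ := Nat.exists_eq_succ_of_ne_zero hd.ne'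
  have hpos : (0 : ℚ) < (e.succ : ℕ) := by positivity
  have h1 : (e : ℚ) ^ n + 1 ≤ ((e : ℚ) + 1) ^ n := by
    have := pow_add_pow_le (x := (e : ℚ)) (y := 1) (by positivity) (by norm_num) (n := n) (by omega)
    simpa using this
  have h2 : ((-1 : ℚ)) ^ (n + 1) ≤ 1 := by
    rcases neg_one_pow_eq_or ℚ (n + 1) with h | h <;> simp [h]
  have h3 : (h : ℚ) ≤ (e.succ : ℚ) ^ n := by
    rw [hh, one_div, inv_mul_le_iff₀ hpos]
    have he : (0 : ℚ) ≤ e := by positivity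
    push_cast
    have h4 := mul_le_mul_of_nonneg_right h2 he
    have h5 := mul_le_mul_of_nonneg_left h1 he
    have h6 : (0 : ℚ) ≤ ((e : ℚ) + 1) ^ n := by positivity
    have h7 : ((e : ℚ) + 1 - 1) = e := by ring
    rw [h7, pow_succ]
    linarith
  exact_mod_cast h3

/-! ### Assembly of the dimension formula. -/

section Main

open MvPolynomial

/-- The dimension of `H_f^pr` for a form `f` with finite-dimensional Jacobian ring. -/
theorem finrank_Hpr_eq {L : Type*} [Field L] [CharZero L] (n : ℕ) (hn : 1 ≤ n) (d : ℕ)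
    (f : MvPolynomial (Fin (n + 1)) L) (hf : f.IsHomogeneous d)
    (hreg : FiniteDimensional L
      (MvPolynomial (Fin (n + 1)) L ⧸ jacobianIdeal f)) :
    FiniteDimensional L (Hpr f) ∧
    (Module.finrank L (Hpr f) : ℚ) =
      1 / (d : ℚ) * (((d : ℚ) - 1) ^ (n + 1) + (-1) ^ (n + 1) * ((d : ℚ) - 1)) ∧
    Module.finrank L (Hpr f) ≤ d ^ n := by
  have hfd := mem_gr_natCast.2 hf
  -- A power of a variable lies in J. This excludes f = 0 and d = 0.
  have hJ : jacobianIdeal f ≠ ⊥ := by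
    intro hJ
    have h0 : HomIdeal (jacobianIdeal f) := homIdeal_span_range fun i => gr_pderiv hfd i
    obtain ⟨K, hK⟩ := exists_X_pow_mem h0 hreg 0
    rw [hJ, Ideal.mem_bot] at hK
    exact pow_ne_zero K (X_ne_zero _) hK
  have hf0 : f ≠ 0 := by
    rintro rfl
    refine hJ (Ideal.span_eq_bot.2 ?_)
    rintro _ ⟨i, rfl⟩
    simp
  have hd : 0 < d := by
    rcases Nat.eq_zero_or_pos d with rfl | hd
    · refine absurd (Ideal.span_eq_bot.2 ?_) hJ
      rintro _ ⟨i, rfl⟩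
      exact eq_zero_of_mem_gr_neg (by simp) (gr_pderiv hfd i)
    · exact hd
  obtain ⟨e, rfl⟩ : ∃ e, d = e + 1 := ⟨d - 1, by omega⟩
  have hgr : ∀ i, pderiv i f ∈ gr L (Fin (n + 1)) (e : ℤ) := fun i => by
    simpa using gr_pderiv hfd i
  have hk := (koszul_and_hilbSeries (Nat.succ_pos n) hgr hreg).1
  have hs := hilbSeries_eq_geom (Nat.succ_pos n) hgr hreg
  set G : Polynomial ℚ := (∑ i ∈ Finset.range e, Polynomial.X ^ i) ^ (n + 1) with hG
  have hcoeff : ∀ p : ℕ, (hilb (jacobianIdeal f) p : ℚ) = G.coeff p := fun p => by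
    have := congrArg (PowerSeries.coeff p) hs
    rwa [hilbSeries, PowerSeries.coeff_mk, Polynomial.coeff_coe] at this
  have hlarge : ∀ p : ℕ, G.natDegree < p →
      gr L (Fin (n + 1)) p ≤ (jacobianIdeal f).restrictScalars L := by
    intro p hp
    have h1 := hcoeff p
    rw [Polynomial.coeff_eq_zero_of_natDegree_lt hp, Int.cast_eq_zero, hilb] at h1
    have h2 : idealPart (jacobianIdeal f) (p : ℤ) = gr L (Fin (n + 1)) p :=
      Submodule.eq_of_le_of_finrank_eq inf_le_right (by omega)
    exact inf_eq_right.1 h2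
  -- For k > T one has kd - n - 1 ≥ k - (n + 1) > deg G, a degree in which J is everything.
  set T := G.natDegree + (n + 1) with hT
  obtain ⟨hfin, hdim⟩ := finrank_Hpr hn hd hfd hf0 hk (T := T) (by
    intro k hTk
    have h1 : k ≤ k * (e + 1) := Nat.le_mul_of_pos_right k hd
    have h2 : ((k : ℤ) * (e + 1 : ℕ) - (n + 1 : ℕ)) = (k * (e + 1) - (n + 1) : ℕ) := by
      rw [Nat.cast_sub (by omega)]
      push_cast
      ring
    rw [h2]
    exact hlarge _ (by omega))
  -- The factor X^(n+1) absorbs the shift by n + 1; if kd < n + 1, both sides are zero.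
  have hterm : ∀ k : ℕ, (hilb (jacobianIdeal f) ((k : ℤ) * (e + 1 : ℕ) - (n + 1 : ℕ)) : ℚ) =
      (Polynomial.X ^ (n + 1) * G).coeff (k * (e + 1)) := by
    intro k
    rw [Polynomial.coeff_X_pow_mul']
    split_ifs with h
    · rw [← hcoeff, Nat.cast_sub h]
      push_cast
      rfl
    · rw [hilb_neg _ (by push_cast at h ⊢; zify at h; linarith), Int.cast_zero]
  have hdimQ : (Module.finrank L (Hpr f) : ℚ) = 1 / ((e + 1 : ℕ) : ℚ) *
      ((((e + 1 : ℕ) : ℚ) - 1) ^ (n + 1) + (-1) ^ (n + 1) * (((e + 1 : ℕ) : ℚ) - 1)) := by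
    have h1 : (Module.finrank L (Hpr f) : ℚ) =
        ∑ k ∈ Finset.range (T + 1), (Polynomial.X ^ (n + 1) * G).coeff (k * (e + 1)) := by
      rw [← Finset.sum_congr rfl fun k _ => hterm k, ← Int.cast_sum, ← hdim, Int.cast_natCast]
    have h2 : (Polynomial.X ^ (n + 1) * G).natDegree < (e + 1) * (T + 1) := by
      refine (Polynomial.natDegree_mul_le).trans_lt ?_
      rw [Polynomial.natDegree_X_pow]
      calc n + 1 + G.natDegree < T + 1 := by omega
        _ ≤ (e + 1) * (T + 1) := Nat.le_mul_of_pos_left _ hd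
    rw [h1, ← multSum_eq_sum hd _ h2, hG, ← mul_pow, multSum_pow]
    push_cast
    ring
  exact ⟨hfin, hdimQ, dim_le_pow hn hd hdimQ⟩

end Main

end GriffithsDwork

end

theorem mainTheorem5 {L : Type*} [Field L] [CharZero L] (n : ℕ) (hn : 1 ≤ n) (d : ℕ)
    (f : MvPolynomial (Fin (n + 1)) L) (hf : f.IsHomogeneous d)
    (hreg : FiniteDimensional L
      (MvPolynomial (Fin (n + 1)) L ⧸ GriffithsDwork.jacobianIdeal f)) :
    FiniteDimensional L (GriffithsDwork.Hpr f) ∧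
    (Module.finrank L (GriffithsDwork.Hpr f) : ℚ) =
      1 / (d : ℚ) * (((d : ℚ) - 1) ^ (n + 1) + (-1) ^ (n + 1) * ((d : ℚ) - 1)) ∧
    Module.finrank L (GriffithsDwork.Hpr f) ≤ d ^ n :=
  GriffithsDwork.finrank_Hpr_eq n hn d f hf hreg
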